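/- Let $\Bbbk$ be a field. For an augmented $\Bbbk$-algebra $(A,\varepsilon)$ with augmentation ideal $A_+=\ker\varepsilon$, let $\Omega^n(A)=\operatorname{Hom}_\Bbbk(A_+^{\otimes n},\Bbbk)$ be the normalized bar complex, with differential $$\delta^n(f)(\lambda_0,\dots,\lambda_n)=\sum_{i=0}^{n-1}(-1)^{i+1}f(\lambda_0,\dots,\lambda_i\lambda_{i+1},\dots,\lambda_n)$$ and product $(fg)(\lambda_1,\dots,\lambda_{n+m})=f(\lambda_1,\dots,\lambda_n)\,g(\lambda_{n+1},\dots,\lambda_{n+m})$. The Yoneda ring $E(A)=\bigoplus_{n\ge 0}E_n(A)$, $E_n(A)=\operatorname{Ext}^n_A(\Bbbk,\Bbbk)=H^n(\Omega^*(A))$, is its cohomology algebra, an $\mathbb N$-graded algebra. **Theorem.** Let $H$ be a semisimple Hopf algebra over $\Bbbk$, with counit $\varepsilon_H$ and antipode $S$. Then $H$ is finite dimensional and $S$ is bijective; let $\overline S=S^{-1}$. (1) Let $\Lambda=\bigoplus_{n\ge0}\Lambda_n$ be a finite-dimensional connected ($\Lambda_0=\Bbbk$) $\mathbb N$-graded $H$-module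 algebra, that is, a graded algebra with an $H$-action on each $\Lambda_n$ such that $h\cdot 1=\varepsilon_H(h)1$ and $h\cdot(xy)=(h_{(1)}\cdot x)(h_{(2)}\cdot y)$. Augment $\Lambda$ by the projection $\varepsilon_\Lambda:\Lambda\to\Lambda_0=\Bbbk$, and the smash product $\Lambda\#H$ (the space $\Lambda\otimes H$ with $(a\#h)(b\#g)=a(h_{(1)}\cdot b)\#h_{(2)}g$) by $a\#h\mapsto\varepsilon_\Lambda(a)\varepsilon_H(h)$. For $h\in H$ and $f\in\Omega^n(\Lambda)$ put $(h\cdot f)(x)=f(\overline S(h)\cdot x)$ for $x\in\Lambda_+^{\otimes n}$, where $H$ acts diagonally on $\Lambda_+^{\otimes n}$, $h\cdot(x_1\otimes\cdots\otimes x_n)=h_{(1)}\cdot x_1\otimes\cdots\otimes h_{(n)}\cdot x_n$. This is compatible with $\delta$ and so induces an action of $H$ on $E(\Lambda)$. Then $E(\Lambda)^H=\{\omega\in E(\Lambda)\mid h\cdot\omega=\varepsilon_H(h)\omega\ \text{for all }h\in H\}$ is a subalgebra of $E(\Lambda)$, and there is an isomorphism of graded algebras $$E(\Lambda\#H)\cong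 E(\Lambda)^H .$$ (2) In particular, if $\Lambda$ is a finite-dimensional connected $\mathbb N$-graded algebra in the category ${}_H^H\mathcal{YD}$ of (left-left) Yetter–Drinfeld modules over $H$ (each $\Lambda_n$ being a Yetter–Drinfeld submodule), then $\Lambda$ is an $H$-module algebra, so that $\Lambda\#H$ makes sense, and the isomorphism $E(\Lambda\#H)\cong E(\Lambda)^H$ of (1) holds. -/

import Mathlib

open scoped TensorProduct DirectSum

noncomputable section

namespace BarCohomology

section Bar

variable (k : Type*) [Field k] (I : Type*) [NonUnitalRing I] [Module k I]

/-- The space `Ωⁿ = Hom_k(I^{⊗n}, k)` of normalized bar cochains with coefficients in the trivial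
module `k`; in the applications `I` is the augmentation ideal of an augmented algebra. -/
abbrev Cochain (n : ℕ) : Type _ := MultilinearMap k (fun _ : Fin n => I) k

variable {k I}

/-- The product of cochains,
`(f g)(λ₁, …, λₙ₊ₘ) = f(λ₁, …, λₙ) g(λₙ₊₁, …, λₙ₊ₘ)`. -/
def mulCochain {n m : ℕ} (f : Cochain k I n) (g : Cochain k I m) : Cochain k I (n + m) :=
  ((LinearMap.mul' k k).compMultilinearMap (f.domCoprod g)).domDomCongr finSumFinEquiv

theorem mulCochain_apply {n m : ℕ} (f : Cochain k I n) (g : Cochain k I m) (v : Fin (n + m) → I) :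
    mulCochain f g v = f (fun i => v (Fin.castAdd m i)) * g (fun j => v (Fin.natAdd n j)) := by
  simp [mulCochain]

variable (k) [IsScalarTower k I I] [SMulCommClass k I I]

theorem contractNth_update {n : ℕ} (j : Fin n) (v : Fin (n + 1) → I) (i : Fin (n + 1)) :
    ∃ (p : Fin n) (φ : I →ₗ[k] I), ∀ [DecidableEq (Fin (n + 1))] (x : I),
      Fin.contractNth j.castSucc (· * ·) (Function.update v i x) =
        Function.update (Fin.contractNth j.castSucc (· * ·) v) p (φ x) := by
  rcases lt_trichotomy (i : ℕ) j with h | h | h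
  · refine ⟨⟨i, by omega⟩, LinearMap.id, fun x => ?_⟩
    ext q
    simp only [Fin.contractNth, Function.update_apply, Fin.ext_iff, Fin.val_castSucc, Fin.val_succ,
      LinearMap.id_apply]
    split_ifs <;> first | rfl | omega
  · obtain rfl : i = j.castSucc := Fin.ext h
    refine ⟨j, LinearMap.mulRight k (v j.succ), fun x => ?_⟩
    ext q
    rcases eq_or_ne q j with rfl | hq
    · simp [Fin.contractNth, Fin.ext_iff]
    · have hq' : (q : ℕ) ≠ j := fun e => hq (Fin.ext e)
      simp only [Fin.contractNth, Function.update_apply, Fin.ext_iff, Fin.val_castSucc,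
        Fin.val_succ]
      split_ifs <;> first | rfl | omega
  · by_cases h' : (i : ℕ) = j + 1
    · obtain rfl : i = j.succ := Fin.ext h'
      refine ⟨j, LinearMap.mulLeft k (v j.castSucc), fun x => ?_⟩
      ext q
      rcases eq_or_ne q j with rfl | hq
      · simp [Fin.contractNth, Fin.ext_iff]
      · have hq' : (q : ℕ) ≠ j := fun e => hq (Fin.ext e)
        simp only [Fin.contractNth, Function.update_apply, Fin.ext_iff, Fin.val_castSucc,
          Fin.val_succ]
        split_ifs <;> first | rfl | omega
    · refine ⟨⟨i - 1, by omega⟩, LinearMap.id, fun x => ?_⟩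
      ext q
      simp only [Fin.contractNth, Function.update_apply, Fin.ext_iff, Fin.val_castSucc,
        Fin.val_succ, LinearMap.id_apply]
      split_ifs <;> first | rfl | omega

/-- `(contract j f)(λ₀, …, λₙ) = f(λ₀, …, λⱼλⱼ₊₁, …, λₙ)`. -/
def contract {n : ℕ} (j : Fin n) : Cochain k I n →ₗ[k] Cochain k I (n + 1) where
  toFun f :=
    { toFun := fun v => f (Fin.contractNth j.castSucc (· * ·) v)
      map_update_add' := fun v i x y => by
        obtain ⟨p, φ, h⟩ := contractNth_update k j v i
        simp only [h, map_add, f.map_update_add]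
      map_update_smul' := fun v i c x => by
        obtain ⟨p, φ, h⟩ := contractNth_update k j v i
        simp only [h, map_smul, f.map_update_smul] }
  map_add' _ _ := rfl
  map_smul' _ _ := rfl

/-- The differential `δⁿ : Ωⁿ → Ωⁿ⁺¹` of the normalized bar complex with trivial coefficients,
`(δⁿ f)(λ₀, …, λₙ) = ∑_{i < n} (-1)^{i+1} f(λ₀, …, λᵢλᵢ₊₁, …, λₙ)`. -/
def d (n : ℕ) : Cochain k I n →ₗ[k] Cochain k I (n + 1) :=
  ∑ i : Fin n, (-1 : k) ^ ((i : ℕ) + 1) • contract k i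

variable {k}

theorem contract_apply {n : ℕ} (j : Fin n) (f : Cochain k I n) (v : Fin (n + 1) → I) :
    contract k j f v = f (Fin.contractNth j.castSucc (· * ·) v) := rfl

theorem d_apply {n : ℕ} (f : Cochain k I n) (v : Fin (n + 1) → I) :
    d k n f v = ∑ i : Fin n, (-1 : k) ^ ((i : ℕ) + 1) *
      f (Fin.contractNth i.castSucc (· * ·) v) := by
  simp [d, contract_apply, LinearMap.sum_apply]

theorem leibniz {n m : ℕ} (f : Cochain k I n) (g : Cochain k I m) (v : Fin (n + m + 1) → I) :
    d k (n + m) (mulCochain f g) v =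
      d k n f (fun i => v (Fin.cast (by omega) (Fin.castAdd m i))) *
          g (fun j => v (Fin.cast (by omega) (Fin.natAdd (n + 1) j))) +
        (-1) ^ n * (f (fun i => v (Fin.cast (by omega) (Fin.castAdd (m + 1) i))) *
          d k m g (fun j => v (Fin.cast (by omega) (Fin.natAdd n j)))) := by
  simp only [d_apply, Fin.sum_univ_add, Finset.sum_mul, Finset.mul_sum, mulCochain_apply]
  congr 1
  · refine Finset.sum_congr rfl fun i _ => ?_
    have h1 : (fun q : Fin n => Fin.contractNth (Fin.castAdd m i).castSucc (· * ·) v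
        (Fin.castAdd m q)) = Fin.contractNth i.castSucc (· * ·)
          (fun j => v (Fin.cast (by omega) (Fin.castAdd m j))) := by
      ext q
      simp only [Fin.contractNth, Fin.val_castSucc, Fin.val_castAdd]
      rfl
    have h2 : (fun q : Fin m => Fin.contractNth (Fin.castAdd m i).castSucc (· * ·) v
        (Fin.natAdd n q)) = fun q => v (Fin.cast (by omega) (Fin.natAdd (n + 1) q)) := by
      ext q
      have := i.2
      simp only [Fin.contractNth, Fin.val_castSucc, Fin.val_castAdd, Fin.val_natAdd]
      rw [if_neg (by omega), if_neg (by omega)]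
      congr 1; ext; simp; omega
    simp only [Fin.val_castAdd]
    rw [h1, h2]; ring
  · refine Finset.sum_congr rfl fun i _ => ?_
    have : (-1 : k) ^ (n + (i : ℕ) + 1) = (-1) ^ n * (-1) ^ ((i : ℕ) + 1) := by ring
    simp only [Fin.val_natAdd, this]
    have h1 : (fun q : Fin n => Fin.contractNth (Fin.natAdd n i).castSucc (· * ·) v
        (Fin.castAdd m q)) = fun q => v (Fin.cast (by omega) (Fin.castAdd (m + 1) q)) := by
      ext q
      have := q.2
      simp only [Fin.contractNth, Fin.val_castSucc, Fin.val_castAdd, Fin.val_natAdd]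
      rw [if_pos (by omega)]
      rfl
    have h2 : (fun q : Fin m => Fin.contractNth (Fin.natAdd n i).castSucc (· * ·) v
        (Fin.natAdd n q)) = Fin.contractNth i.castSucc (· * ·)
          (fun j => v (Fin.cast (by omega) (Fin.natAdd n j))) := by
      ext q
      simp only [Fin.contractNth, Fin.val_castSucc, Fin.val_natAdd, add_lt_add_iff_left,
        add_right_inj]
      rfl
    rw [h1, h2]; ring


variable (k I)

/-- The cocycles of degree `n`. -/
def cocycles (n : ℕ) : Submodule k (Cochain k I n) := LinearMap.ker (d k n)

/-- The coboundaries of degree `n`. -/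
def coboundaries : (n : ℕ) → Submodule k (Cochain k I n)
  | 0 => ⊥
  | n + 1 => LinearMap.range (d k n)

/-- The space of cocycles, as a type. -/
def Cocycle (n : ℕ) : Type _ := cocycles k I n

instance (n : ℕ) : AddCommGroup (Cocycle k I n) := inferInstanceAs (AddCommGroup (cocycles k I n))

instance (n : ℕ) : Module k (Cocycle k I n) := inferInstanceAs (Module k (cocycles k I n))

/-- The inclusion of the cocycles into the cochains. -/
def Cocycle.incl (n : ℕ) : Cocycle k I n →ₗ[k] Cochain k I n := (cocycles k I n).subtype

/-- The `n`-th cohomology space `Eₙ` of the normalized bar complex: cocycles modulo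
coboundaries. -/
abbrev Coh (n : ℕ) : Type _ := Cocycle k I n ⧸ (coboundaries k I n).comap (Cocycle.incl k I n)

variable {k I}

theorem Cocycle.add_val {n : ℕ} (f g : Cocycle k I n) : (f + g).1 = f.1 + g.1 := rfl

theorem Cocycle.smul_val {n : ℕ} (c : k) (f : Cocycle k I n) : (c • f).1 = c • f.1 := rfl

theorem mem_coboundaries_of_eq {M N : ℕ} (h : M + 1 = N) (f : Cochain k I N) (f' : Cochain k I M)
    (hf : ∀ v, f v = d k M f' (fun i => v (Fin.cast h i))) : f ∈ coboundaries k I N := by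
  subst h
  exact ⟨f', MultilinearMap.ext fun v => (hf v).symm⟩

theorem mulCochain_mem_cocycles {n m : ℕ} {f : Cochain k I n} {g : Cochain k I m}
    (hf : f ∈ cocycles k I n) (hg : g ∈ cocycles k I m) :
    mulCochain f g ∈ cocycles k I (n + m) := by
  refine MultilinearMap.ext fun v => ?_
  have hf' : d k n f = 0 := hf
  have hg' : d k m g = 0 := hg
  rw [leibniz, hf', hg']
  simp

theorem mulCochain_mem_coboundaries_left {n m : ℕ} {f : Cochain k I n} {g : Cochain k I m}
    (hf : f ∈ coboundaries k I n) (hg : g ∈ cocycles k I m) :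
    mulCochain f g ∈ coboundaries k I (n + m) := by
  have hg' : d k m g = 0 := hg
  match n, f, hf with
  | 0, f, hf =>
    have : f = 0 := hf
    have h0 : mulCochain f g = 0 := by
      refine MultilinearMap.ext fun v => ?_
      rw [mulCochain_apply, this]
      simp
    rw [h0]
    exact zero_mem _
  | n + 1, _, ⟨f', rfl⟩ =>
    refine mem_coboundaries_of_eq (M := n + m) (by omega) _ (mulCochain f' g) fun v => ?_
    rw [leibniz, hg', mulCochain_apply]
    simp only [zero_apply, mul_zero, add_zero]
    rfl

theorem mulCochain_mem_coboundaries_right {n m : ℕ} {f : Cochain k I n} {g : Cochain k I m}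
    (hf : f ∈ cocycles k I n) (hg : g ∈ coboundaries k I m) :
    mulCochain f g ∈ coboundaries k I (n + m) := by
  have hf' : d k n f = 0 := hf
  match m, g, hg with
  | 0, g, hg =>
    have : g = 0 := hg
    have h0 : mulCochain f g = 0 := by
      refine MultilinearMap.ext fun v => ?_
      rw [mulCochain_apply, this]
      simp
    rw [h0]
    exact zero_mem _
  | m + 1, _, ⟨g', rfl⟩ =>
    refine mem_coboundaries_of_eq (M := n + m) (by omega) _ ((-1 : k) ^ n • mulCochain f g')
      fun v => ?_
    rw [map_smul, smul_apply, leibniz, hf', mulCochain_apply]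
    simp only [zero_apply, zero_mul, zero_add, smul_eq_mul]
    rw [← mul_assoc, ← pow_add, Even.neg_one_pow ⟨n, rfl⟩, one_mul]
    rfl

/-- The product of cocycles. -/
def mulCocycle {n m : ℕ} (f : Cocycle k I n) (g : Cocycle k I m) : Cocycle k I (n + m) :=
  ⟨mulCochain f.1 g.1, mulCochain_mem_cocycles f.2 g.2⟩

theorem mulCocycle_apply {n m : ℕ} (f : Cocycle k I n) (g : Cocycle k I m)
    (v : Fin (n + m) → I) : (mulCocycle f g).1 v =
      f.1 (fun i => v (Fin.castAdd m i)) * g.1 (fun j => v (Fin.natAdd n j)) :=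
  mulCochain_apply _ _ _

theorem Cocycle.ext {n : ℕ} {f g : Cocycle k I n} (h : ∀ v, f.1 v = g.1 v) : f = g :=
  Subtype.ext (MultilinearMap.ext h)

/-- The product of cocycles as a bilinear map. -/
def mulCocycles (n m : ℕ) : Cocycle k I n →ₗ[k] Cocycle k I m →ₗ[k] Cocycle k I (n + m) :=
  LinearMap.mk₂ k mulCocycle
    (fun f f' g => Cocycle.ext fun v => by
      rw [Cocycle.add_val, add_apply]
      simp only [mulCocycle_apply, Cocycle.add_val, add_apply, add_mul])
    (fun c f g => Cocycle.ext fun v => by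
      rw [Cocycle.smul_val, smul_apply]
      simp only [mulCocycle_apply, Cocycle.smul_val, smul_apply, smul_eq_mul, mul_assoc])
    (fun f g g' => Cocycle.ext fun v => by
      rw [Cocycle.add_val, add_apply]
      simp only [mulCocycle_apply, Cocycle.add_val, add_apply, mul_add])
    (fun c f g => Cocycle.ext fun v => by
      rw [Cocycle.smul_val, smul_apply]
      simp only [mulCocycle_apply, Cocycle.smul_val, smul_apply, smul_eq_mul, mul_left_comm])

/-- The product `Eₙ × Eₘ → Eₙ₊ₘ` induced by the product of cochains. -/
def mulCoh (n m : ℕ) : Coh k I n →ₗ[k] Coh k I m →ₗ[k] Coh k I (n + m) :=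
  LinearMap.liftQ₂ _ _ ((mulCocycles n m).compr₂ (Submodule.mkQ _))
    (fun _ hf => LinearMap.ext fun g => (Submodule.Quotient.mk_eq_zero _).2
      (mulCochain_mem_coboundaries_left hf g.2))
    (fun _ hg => LinearMap.ext fun f => (Submodule.Quotient.mk_eq_zero _).2
      (mulCochain_mem_coboundaries_right f.2 hg))

/-- The scalars, as cocycles of degree `0`. -/
def scalarCocycle : k →ₗ[k] Cocycle k I 0 where
  toFun c := ⟨MultilinearMap.constOfIsEmpty k (fun _ => I) c,
    MultilinearMap.ext fun v => by simp [d_apply]⟩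
  map_add' _ _ := rfl
  map_smul' _ _ := rfl

/-- The scalars, as cohomology classes of degree `0`. -/
def scalar : k →ₗ[k] Coh k I 0 := (Submodule.mkQ _).comp scalarCocycle

theorem scalarCocycle_apply (c : k) (v : Fin 0 → I) : (scalarCocycle (I := I) c).1 v = c := rfl

theorem coh_mk_eq {n m : ℕ} (h : n = m) (f : Cocycle k I n) (g : Cocycle k I m)
    (hfg : ∀ v, f.1 v = g.1 (fun i => v (Fin.cast h.symm i))) :
    (GradedMonoid.mk n (Submodule.Quotient.mk f) : GradedMonoid (Coh k I)) =
      GradedMonoid.mk m (Submodule.Quotient.mk g) := by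
  subst h
  have : f = g := Cocycle.ext hfg
  rw [this]

instance : GradedMonoid.GOne (Coh k I) where
  one := scalar 1

instance : GradedMonoid.GMul (Coh k I) where
  mul {n m} a b := mulCoh n m a b

instance : DirectSum.GSemiring (Coh k I) where
  mul_zero _ := map_zero _
  zero_mul {n m} b := LinearMap.map_zero₂ (mulCoh n m) b
  mul_add _ _ _ := map_add _ _ _
  add_mul {n m} a b c := LinearMap.map_add₂ (mulCoh n m) a b c
  one_mul := by
    rintro ⟨n, a⟩
    obtain ⟨f, rfl⟩ := Submodule.Quotient.mk_surjective _ a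
    refine coh_mk_eq (zero_add n) (mulCocycle (scalarCocycle 1) f) f fun v => ?_
    rw [mulCocycle_apply, scalarCocycle_apply, one_mul]
    congr 1; funext i; congr 1; ext; simp
  mul_one := by
    rintro ⟨n, a⟩
    obtain ⟨f, rfl⟩ := Submodule.Quotient.mk_surjective _ a
    refine coh_mk_eq (add_zero n) (mulCocycle f (scalarCocycle 1)) f fun v => ?_
    rw [mulCocycle_apply, scalarCocycle_apply, mul_one]
    rfl
  mul_assoc := by
    rintro ⟨n, a⟩ ⟨m, b⟩ ⟨l, c⟩
    obtain ⟨f, rfl⟩ := Submodule.Quotient.mk_surjective _ a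
    obtain ⟨g, rfl⟩ := Submodule.Quotient.mk_surjective _ b
    obtain ⟨h, rfl⟩ := Submodule.Quotient.mk_surjective _ c
    refine coh_mk_eq (add_assoc n m l) (mulCocycle (mulCocycle f g) h)
      (mulCocycle f (mulCocycle g h)) fun v => ?_
    simp only [mulCocycle_apply, mul_assoc]
    congr 2
    congr 1; funext i; congr 1; ext; simp [add_assoc]
  natCast r := scalar r
  natCast_zero := by simp
  natCast_succ r := by
    rw [Nat.cast_succ, map_add]; rfl

instance : DirectSum.GAlgebra k (Coh k I) where
  toFun := scalar.toAddMonoidHom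
  map_one := rfl
  map_mul r s := by
    refine coh_mk_eq (add_zero 0).symm (scalarCocycle (r * s))
      (mulCocycle (scalarCocycle r) (scalarCocycle s)) fun v => ?_
    rw [mulCocycle_apply]
    rfl
  commutes := by
    rintro r ⟨n, a⟩
    obtain ⟨f, rfl⟩ := Submodule.Quotient.mk_surjective _ a
    refine coh_mk_eq (by simp) (mulCocycle (scalarCocycle r) f)
      (mulCocycle f (scalarCocycle r)) fun v => ?_
    simp only [mulCocycle_apply, scalarCocycle_apply]
    rw [mul_comm]
    congr 2; funext i; congr 1; ext; simp
  smul_def := by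
    rintro r ⟨n, a⟩
    obtain ⟨f, rfl⟩ := Submodule.Quotient.mk_surjective _ a
    refine coh_mk_eq (zero_add n).symm (r • f) (mulCocycle (scalarCocycle r) f) fun v => ?_
    rw [mulCocycle_apply, scalarCocycle_apply, Cocycle.smul_val, smul_apply, smul_eq_mul]
    congr 2; funext i; congr 1; ext; simp

variable (k I)

/-- The `ℕ`-graded cohomology algebra `⨁ₙ Eₙ` of the normalized bar complex of `I`. -/
abbrev CohRing : Type _ := ⨁ n, Coh k I n

/-- The component of degree `n` of the cohomology algebra. -/
def CohRing.piece (n : ℕ) : Submodule k (CohRing k I) :=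
  LinearMap.range (DirectSum.lof k ℕ (Coh k I) n)

end Bar

section Action

open Coalgebra

variable (k : Type*) [Field k] (H : Type*) [Ring H] [Bialgebra k H]

/-- The map `(x, y₁ ⊗ ⋯ ⊗ yₙ) ↦ x ⊗ y₁ ⊗ ⋯ ⊗ yₙ`. -/
def tensorCons (V : Type*) [AddCommGroup V] [Module k V] (n : ℕ) :
    V →ₗ[k] (⨂[k]^n V) →ₗ[k] ⨂[k]^(n + 1) V :=
  (PiTensorProduct.lift (R := k) (s := fun _ : Fin n => V) (E := ⨂[k]^(n + 1) V)).toLinearMap ∘ₗ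
    (PiTensorProduct.tprod k (s := fun _ : Fin (n + 1) => V)).curryLeft

/-- The iterated comultiplication `h ↦ h₍₁₎ ⊗ ⋯ ⊗ h₍ₙ₎`; it is the counit for `n = 0`. -/
def iterComul : (n : ℕ) → H →ₗ[k] ⨂[k]^n H
  | 0 => (counit (R := k) (A := H)).smulRight (PiTensorProduct.tprod k (fun i : Fin 0 => i.elim0))
  | n + 1 => TensorProduct.lift ((tensorCons k H n).compl₂ (iterComul n)) ∘ₗ comul

variable {k H} {I : Type*} [NonUnitalRing I] [Module k I]

/-- The diagonal action `h · (x₁ ⊗ ⋯ ⊗ xₙ) = h₍₁₎x₁ ⊗ ⋯ ⊗ h₍ₙ₎xₙ` on the tensor powers, for an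
action `act` of `H` on `I`. -/
def diagonalAct (act : H →ₗ[k] I →ₗ[k] I) (n : ℕ) : H →ₗ[k] (⨂[k]^n I) →ₗ[k] ⨂[k]^n I :=
  PiTensorProduct.map₂ (fun _ : Fin n => act) ∘ₗ iterComul k H n

/-- The map `(h, f) ↦ f(h · -)` on cochains, for the diagonal action of `H` on `I^{⊗n}`. -/
def pullback (act : H →ₗ[k] I →ₗ[k] I) (n : ℕ) : H →ₗ[k] Cochain k I n →ₗ[k] Cochain k I n :=
  LinearMap.mk₂ k
    (fun h f => PiTensorProduct.lift.symm (PiTensorProduct.lift f ∘ₗ diagonalAct act n h))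
    (fun h h' f => by rw [map_add, LinearMap.comp_add, map_add])
    (fun c h f => by rw [map_smul, LinearMap.comp_smul, map_smul])
    (fun h f f' => by rw [map_add, LinearMap.add_comp, map_add])
    (fun c h f => by rw [map_smul, LinearMap.smul_comp, map_smul])

variable (act : H →ₗ[k] I →ₗ[k] I)

theorem pullback_apply {n : ℕ} (h : H) (f : Cochain k I n) (v : Fin n → I) :
    pullback act n h f v =
      PiTensorProduct.lift f (diagonalAct act n h (PiTensorProduct.tprod k v)) := rfl

theorem tensorCons_tprod (V : Type*) [AddCommGroup V] [Module k V] {n : ℕ} (x : V)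
    (v : Fin n → V) : tensorCons k V n x (PiTensorProduct.tprod k v) =
      PiTensorProduct.tprod k (Fin.cons x v : Fin (n + 1) → V) := by
  simp [tensorCons]

theorem map₂_tensorCons {n : ℕ} (h : H) (t : ⨂[k]^n H) (x : I) (v : Fin n → I) :
    PiTensorProduct.map₂ (fun _ : Fin (n + 1) => act) (tensorCons k H n h t)
        (PiTensorProduct.tprod k (Fin.cons x v : Fin (n + 1) → I)) =
      tensorCons k I n (act h x)
        (PiTensorProduct.map₂ (fun _ : Fin n => act) t (PiTensorProduct.tprod k v)) := by
  induction t using PiTensorProduct.induction_on with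
  | smul_tprod r w =>
    simp only [map_smul, LinearMap.smul_apply, tensorCons_tprod,
      PiTensorProduct.map₂_tprod_tprod]
    congr 2
    funext i
    refine Fin.cases ?_ (fun i => ?_) i <;> simp
  | add s t hs ht => simp only [map_add, LinearMap.add_apply, hs, ht]

theorem lift_tensorCons {n : ℕ} (f : Cochain k I (n + 1)) (x : I) (t : ⨂[k]^n I) :
    PiTensorProduct.lift f (tensorCons k I n x t) = PiTensorProduct.lift (f.curryLeft x) t := by
  induction t using PiTensorProduct.induction_on with
  | smul_tprod r w =>
    simp only [map_smul, tensorCons_tprod, PiTensorProduct.lift.tprod]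
    rfl
  | add s t hs ht => simp only [map_add, hs, ht]

theorem pullback_cons {n : ℕ} {ι : Type*} {h : H} (r : Repr k h ι) (f : Cochain k I (n + 1)) (x : I)
    (v : Fin n → I) : pullback act (n + 1) h f (Fin.cons x v : Fin (n + 1) → I) =
      ∑ i ∈ r.index, pullback act n (r.right i) (f.curryLeft (act (r.left i) x)) v := by
  simp only [pullback_apply, diagonalAct, LinearMap.comp_apply, iterComul, ← r.eq, map_sum,
    TensorProduct.lift.tmul, LinearMap.compl₂_apply, LinearMap.sum_apply, map₂_tensorCons,
    lift_tensorCons]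

theorem pullback_curryLeft {n : ℕ} {ι : Type*} {h : H} (r : Repr k h ι) (f : Cochain k I (n + 1))
    (x : I) : (pullback act (n + 1) h f).curryLeft x =
      ∑ i ∈ r.index, pullback act n (r.right i) (f.curryLeft (act (r.left i) x)) := by
  refine MultilinearMap.ext fun v => ?_
  rw [MultilinearMap.curryLeft_apply, pullback_cons act r]
  simp

variable [IsScalarTower k I I] [SMulCommClass k I I]

theorem d_cons {n : ℕ} (f : Cochain k I (n + 1)) (x y : I) (v : Fin n → I) :
    d k (n + 1) f (Fin.cons x (Fin.cons y v : Fin (n + 1) → I) : Fin (n + 2) → I) =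
      -(f (Fin.cons (x * y) v : Fin (n + 1) → I)) -
        d k n (f.curryLeft x) (Fin.cons y v : Fin (n + 1) → I) := by
  rw [d_apply, Fin.sum_univ_succ, d_apply, sub_eq_add_neg, ← Finset.sum_neg_distrib]
  congr 1
  · simp only [Fin.val_zero, zero_add, pow_one, neg_one_mul]
    congr 2
    funext i
    refine Fin.cases ?_ (fun i => ?_) i <;> simp [Fin.contractNth]
  · refine Finset.sum_congr rfl fun i _ => ?_
    rw [Fin.val_succ, pow_succ, mul_neg_one, neg_mul, MultilinearMap.curryLeft_apply]
    congr 3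
    funext q
    refine Fin.cases ?_ (fun q => ?_) q
    · simp [Fin.contractNth]
    · simp [Fin.contractNth]

/-- The bar complex is a complex: `δⁿ⁺¹ ∘ δⁿ = 0`. -/
theorem d_d (n : ℕ) (f : Cochain k I n) : d k (n + 1) (d k n f) = 0 := by
  induction n with
  | zero =>
    have : d k 0 f = 0 := by
      refine MultilinearMap.ext fun v => ?_
      rw [d_apply]; simp
    rw [this, map_zero]
  | succ n ih =>
    refine MultilinearMap.ext fun w => ?_
    obtain ⟨x, y, z, v, rfl⟩ : ∃ (x y z : I) (v : Fin n → I),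
        w = (Fin.cons x (Fin.cons y (Fin.cons z v : Fin (n + 1) → I) : Fin (n + 2) → I) :
          Fin (n + 3) → I) :=
      ⟨w 0, Fin.tail w 0, Fin.tail (Fin.tail w) 0, Fin.tail (Fin.tail (Fin.tail w)), by
        simp only [Fin.cons_self_tail]⟩
    let hm : Cochain k I (n + 1) := (f.curryLeft ∘ₗ LinearMap.mulLeft k x).uncurryLeft
    have e : (d k (n + 1) f).curryLeft x = -hm - d k n (f.curryLeft x) := by
      refine MultilinearMap.ext fun u => ?_
      obtain ⟨y, v, rfl⟩ : ∃ y v, u = (Fin.cons y v : Fin (n + 1) → I) :=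
        ⟨u 0, Fin.tail u, by simp⟩
      exact d_cons f x y v
    have e2 : ∀ y, hm.curryLeft y = f.curryLeft (x * y) := fun y => by
      refine MultilinearMap.ext fun u => ?_
      simp [hm]
    rw [d_cons, e, map_sub, map_neg, ih, d_cons]
    simp only [sub_zero, neg_apply]
    rw [d_cons, e2]
    simp [hm, mul_assoc]

/-- The compatibility of an action of `H` on `I` with the multiplication of `I`,
`h · (xy) = (h₍₁₎ · x)(h₍₂₎ · y)`. -/
def ActsOnMul : Prop := ∀ (h : H) (x y : I),
  act h (x * y) = TensorProduct.lift ((LinearMap.mul k I).compl₁₂ (act.flip x) (act.flip y))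
    (comul h)

variable {act}

theorem ActsOnMul.repr (hact : ActsOnMul act) {ι : Type*} {h : H} (r : Repr k h ι) (x y : I) :
    act h (x * y) = ∑ i ∈ r.index, act (r.left i) x * act (r.right i) y := by
  rw [hact, ← r.eq, map_sum]
  simp

theorem pullback_mul (hact : ActsOnMul act) {n : ℕ} {h : H} {ι : Type*} (r : Repr k h ι)
    (f : Cochain k I (n + 1)) (x y : I) (v : Fin n → I) :
    pullback act (n + 1) h f (Fin.cons (x * y) v : Fin (n + 1) → I) =
      ∑ i ∈ r.index, ∑ j ∈ (ℛ k (r.right i)).index,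
        pullback act n ((ℛ k (r.right i)).right j)
          (f.curryLeft (act (r.left i) x * act ((ℛ k (r.right i)).left j) y)) v := by
  rw [pullback_cons act r]
  let ev : Cochain k I n →ₗ[k] k :=
    { toFun := fun F => F v, map_add' := fun _ _ => rfl, map_smul' := fun _ _ => rfl }
  let P : I →ₗ[k] H →ₗ[k] k := ((pullback act n).flip ∘ₗ f.curryLeft).compr₂ ev
  let M : H ⊗[k] H →ₗ[k] I :=
    TensorProduct.lift ((LinearMap.mul k I).compl₁₂ (act.flip x) (act.flip y))
  have key := congrArg (TensorProduct.lift (P ∘ₗ M) ∘ₗ (TensorProduct.assoc k H H H).symm)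
    (sum_tmul_tmul_eq r (fun i => ℛ k (r.left i)) (fun i => ℛ k (r.right i)))
  simp only [map_sum, LinearMap.comp_apply, LinearEquiv.coe_coe, TensorProduct.assoc_symm_tmul,
    TensorProduct.lift.tmul] at key
  refine (Finset.sum_congr rfl fun i _ => ?_).trans key
  rw [hact.repr (ℛ k (r.left i)), map_sum, map_sum]
  exact sum_apply _ _ _

/-- The diagonal action is compatible with the differential of the bar complex. -/
theorem d_pullback (hact : ActsOnMul act) {n : ℕ} (h : H) (f : Cochain k I n) :
    d k n (pullback act n h f) = pullback act (n + 1) h (d k n f) := by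
  induction n generalizing h with
  | zero =>
    have h0 : ∀ g : Cochain k I 0, d k 0 g = 0 := fun g => by
      refine MultilinearMap.ext fun v => ?_
      rw [d_apply]; simp
    rw [h0, h0, map_zero]
  | succ n ih =>
    refine MultilinearMap.ext fun w => ?_
    obtain ⟨x, y, v, rfl⟩ : ∃ (x y : I) (v : Fin n → I),
        w = (Fin.cons x (Fin.cons y v : Fin (n + 1) → I) : Fin (n + 2) → I) :=
      ⟨w 0, Fin.tail w 0, Fin.tail (Fin.tail w), by rw [Fin.cons_self_tail, Fin.cons_self_tail]⟩
    let r := ℛ k h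
    rw [d_cons, pullback_curryLeft act r, map_sum, pullback_mul hact r, pullback_cons act r,
      sum_apply, ← Finset.sum_neg_distrib, ← Finset.sum_sub_distrib]
    refine Finset.sum_congr rfl fun i _ => ?_
    rw [ih, pullback_cons act (ℛ k (r.right i)), pullback_cons act (ℛ k (r.right i)),
      ← Finset.sum_neg_distrib, ← Finset.sum_sub_distrib]
    refine Finset.sum_congr rfl fun j _ => ?_
    have hd : ∀ x y : I, ((d k (n + 1) f).curryLeft x).curryLeft y =
        -(f.curryLeft (x * y)) - (d k n (f.curryLeft x)).curryLeft y :=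
      fun x y => MultilinearMap.ext fun v => d_cons f x y v
    rw [hd, map_sub, map_neg]
    rfl

/-- The action `ω ↦ ω(h · -)` of an element `h` on the cocycles. -/
def cocyclePullback (hact : ActsOnMul act) (n : ℕ) (h : H) : Cocycle k I n →ₗ[k] Cocycle k I n :=
  LinearMap.restrict (p := cocycles k I n) (q := cocycles k I n) (pullback act n h) fun f hf => by
    have hf' : d k n f = 0 := hf
    change d k n (pullback act n h f) = 0
    rw [d_pullback hact, hf', map_zero]

theorem pullback_mem_coboundaries (hact : ActsOnMul act) {n : ℕ} (h : H) {f : Cochain k I n}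
    (hf : f ∈ coboundaries k I n) : pullback act n h f ∈ coboundaries k I n := by
  match n, f, hf with
  | 0, f, hf =>
    have : f = 0 := hf
    rw [this, map_zero]
    exact zero_mem _
  | n + 1, _, ⟨f', rfl⟩ => exact ⟨pullback act n h f', d_pullback hact h f'⟩

/-- The map `ω ↦ ω(h · -)` on the cohomology space `Eₙ`. -/
def cohPullback (hact : ActsOnMul act) (n : ℕ) (h : H) : Coh k I n →ₗ[k] Coh k I n :=
  Submodule.mapQ _ _ (cocyclePullback hact n h) fun _ hf => pullback_mem_coboundaries hact h hf

/-- The map `ω ↦ ω(h · -)` on the cohomology algebra. -/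
def cohRingPullback (hact : ActsOnMul act) (h : H) : CohRing k I →ₗ[k] CohRing k I :=
  DirectSum.lmap fun n => cohPullback hact n h

end Action

section ModuleAlgebra

open Coalgebra

variable (k : Type*) [Field k] (H : Type*) [Ring H] (Λ : Type*) [Ring Λ] [Algebra k Λ]

/-- `Λ` is an `H`-module algebra: `h · 1 = ε(h) 1` and `h · (xy) = (h₍₁₎ · x)(h₍₂₎ · y)`. -/
class IsModuleAlgebra [Bialgebra k H] [Module H Λ] [IsScalarTower k H Λ] : Prop where
  smul_one' : ∀ h : H, h • (1 : Λ) = counit (R := k) h • (1 : Λ)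
  smul_mul' : ∀ (h : H) (x y : Λ), h • (x * y) =
    LinearMap.mul' k Λ (TensorProduct.map
      ((Algebra.lsmul k k Λ : H →ₐ[k] Module.End k Λ).toLinearMap.flip x)
      ((Algebra.lsmul k k Λ : H →ₐ[k] Module.End k Λ).toLinearMap.flip y) (comul h))

variable {k Λ}

/-- The augmentation ideal of an augmented algebra. -/
def augIdeal (ε : Λ →ₐ[k] k) : NonUnitalSubalgebra k Λ where
  carrier := {x | ε x = 0}
  add_mem' {x y} hx hy := by
    have hx' : ε x = 0 := hx
    have hy' : ε y = 0 := hy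
    change ε (x + y) = 0
    rw [map_add, hx', hy', add_zero]
  zero_mem' := map_zero ε
  mul_mem' {x y} hx _ := by
    have hx' : ε x = 0 := hx
    change ε (x * y) = 0
    rw [map_mul, hx', zero_mul]
  smul_mem' c x hx := by
    have hx' : ε x = 0 := hx
    change ε (c • x) = 0
    rw [map_smul, hx', smul_zero]

theorem mem_augIdeal {ε : Λ →ₐ[k] k} {x : Λ} : x ∈ augIdeal ε ↔ ε x = 0 := Iff.rfl

/-- The Yoneda ring `E(Λ) = ⨁ₙ Extⁿ_Λ(k, k)` of an augmented algebra `(Λ, ε)`, computed by the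
normalized bar complex `Ωⁿ(Λ) = Hom_k(Λ₊^{⊗n}, k)`, where `Λ₊` is the augmentation ideal. -/
abbrev YonedaRing (ε : Λ →ₐ[k] k) : Type _ := CohRing k (augIdeal ε)

/-- The component `Eₙ(Λ)` of the Yoneda ring. -/
abbrev YonedaRing.piece (ε : Λ →ₐ[k] k) (n : ℕ) : Submodule k (YonedaRing ε) :=
  CohRing.piece k (augIdeal ε) n

variable {H} [Bialgebra k H] [Module H Λ] [IsScalarTower k H Λ]

/-- The action of `H` on the augmentation ideal, for an `H`-linear augmentation. -/
def augAct (ε : Λ →ₐ[k] k) (hε : ∀ (h : H) (x : Λ), ε (h • x) = counit h * ε x) :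
    H →ₗ[k] augIdeal ε →ₗ[k] augIdeal ε :=
  LinearMap.mk₂ k
    (fun h x => ⟨h • x.1, by rw [mem_augIdeal, hε, mem_augIdeal.1 x.2, mul_zero]⟩)
    (fun _ _ _ => Subtype.ext (add_smul _ _ _))
    (fun _ _ _ => Subtype.ext (smul_assoc _ _ _))
    (fun _ _ _ => Subtype.ext (smul_add _ _ _))
    (fun c h x => Subtype.ext (smul_comm h c x.1))

theorem IsModuleAlgebra.smul_mul_repr [IsModuleAlgebra k H Λ] {ι : Type*} {h : H}
    (r : Repr k h ι) (x y : Λ) :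
    h • (x * y) = ∑ i ∈ r.index, (r.left i • x) * (r.right i • y) := by
  rw [IsModuleAlgebra.smul_mul' (k := k), ← r.eq]
  simp

theorem augAct_actsOnMul [IsModuleAlgebra k H Λ] (ε : Λ →ₐ[k] k)
    (hε : ∀ (h : H) (x : Λ), ε (h • x) = counit h * ε x) : ActsOnMul (augAct ε hε) := by
  intro h x y
  let r := ℛ k h
  rw [← r.eq]
  apply Subtype.ext
  have := IsModuleAlgebra.smul_mul_repr r x.1 y.1
  refine this.trans ?_
  simp [augAct]

end ModuleAlgebra

section Smash

open Coalgebra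

variable (k : Type*) [Field k] (Λ : Type*) [Ring Λ] [Algebra k Λ] (H : Type*) [Ring H]

/-- The vector space `Λ ⊗ H` underlying the smash product `Λ # H`. -/
def SmashProduct [Algebra k H] : Type _ := Λ ⊗[k] H

instance [Algebra k H] : AddCommGroup (SmashProduct k Λ H) :=
  inferInstanceAs (AddCommGroup (Λ ⊗[k] H))

instance [Algebra k H] : Module k (SmashProduct k Λ H) := inferInstanceAs (Module k (Λ ⊗[k] H))

variable {k Λ H} [Bialgebra k H]

/-- The linear form `a ⊗ h ↦ ε(a) ε(h)`. -/
def smashCounit (ε : Λ →ₐ[k] k) : Λ ⊗[k] H →ₗ[k] k :=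
  LinearMap.mul' k k ∘ₗ TensorProduct.map ε.toLinearMap (counit (R := k) (A := H))

theorem smashCounit_tmul (ε : Λ →ₐ[k] k) (a : Λ) (h : H) :
    smashCounit ε (a ⊗ₜ[k] h) = ε a * counit (R := k) h := rfl

variable (k Λ H) [Module H Λ] [IsScalarTower k H Λ]

/-- The diagonal action `h · (b ⊗ g) = h₍₁₎b ⊗ h₍₂₎g` on `Λ ⊗ H`. -/
def smashDiag : H →ₐ[k] Module.End k (Λ ⊗[k] H) :=
  (Module.endTensorEndAlgHom (R := k) (S := k) (A := k) (M := Λ) (N := H)).comp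
    ((Algebra.TensorProduct.map (Algebra.lsmul k k Λ) (Algebra.lmul k H)).comp
      (Bialgebra.comulAlgHom k H))

/-- The multiplication of the smash product, `(a # h)(b # g) = a(h₍₁₎ · b) # h₍₂₎g`. -/
def smashMul : Λ ⊗[k] H →ₗ[k] Λ ⊗[k] H →ₗ[k] Λ ⊗[k] H :=
  TensorProduct.lift (LinearMap.mk₂ k
    (fun a h => (LinearMap.mulLeft k a).rTensor H ∘ₗ smashDiag k Λ H h)
    (fun a a' h => by
      have : LinearMap.mulLeft k (a + a') = LinearMap.mulLeft k a + LinearMap.mulLeft k a' :=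
        map_add (LinearMap.mul k Λ) a a'
      rw [this, LinearMap.rTensor_add, LinearMap.add_comp])
    (fun c a h => by
      have : LinearMap.mulLeft k (c • a) = c • LinearMap.mulLeft k a :=
        map_smul (LinearMap.mul k Λ) c a
      rw [this, LinearMap.rTensor_smul, LinearMap.smul_comp])
    (fun a h h' => by rw [map_add, LinearMap.comp_add])
    (fun c a h => by rw [map_smul, LinearMap.comp_smul]))

variable {k Λ H}

theorem smashDiag_tmul {ι : Type*} {h : H} (r : Repr k h ι) (b : Λ) (g : H) :
    smashDiag k Λ H h (b ⊗ₜ g) = ∑ i ∈ r.index, (r.left i • b) ⊗ₜ[k] (r.right i * g) := by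
  simp only [smashDiag, AlgHom.comp_apply, Bialgebra.comulAlgHom_apply, ← r.eq, map_sum,
    LinearMap.sum_apply]
  exact Finset.sum_congr rfl fun _ _ => rfl

theorem smashMul_apply (a : Λ) (h : H) (w : Λ ⊗[k] H) : smashMul k Λ H (a ⊗ₜ h) w =
    (LinearMap.mulLeft k a).rTensor H (smashDiag k Λ H h w) := rfl

theorem smashMul_tmul {ι : Type*} {h : H} (r : Repr k h ι) (a b : Λ) (g : H) :
    smashMul k Λ H (a ⊗ₜ h) (b ⊗ₜ g) =
      ∑ i ∈ r.index, (a * (r.left i • b)) ⊗ₜ[k] (r.right i * g) := by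
  rw [smashMul_apply, smashDiag_tmul r]
  simp

theorem smashMul_one_left (z : Λ ⊗[k] H) : smashMul k Λ H (1 ⊗ₜ 1) z = z := by
  rw [smashMul_apply, map_one, LinearMap.mulLeft_one, LinearMap.rTensor_id]
  rfl

theorem smashCounit_mul (ε : Λ →ₐ[k] k) (hε : ∀ (h : H) (x : Λ), ε (h • x) = counit h * ε x)
    (x y : Λ ⊗[k] H) :
    smashCounit ε (smashMul k Λ H x y) = smashCounit ε x * smashCounit ε y := by
  induction x using TensorProduct.induction_on with
  | zero => simp
  | add s t hs ht => simp only [map_add, LinearMap.add_apply, hs, ht, add_mul]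
  | tmul a h =>
    induction y using TensorProduct.induction_on with
    | zero => simp
    | add s t hs ht => simp only [map_add, hs, ht, mul_add]
    | tmul b g =>
      let r := ℛ k h
      have key : ∑ i ∈ r.index, counit (R := k) (r.left i) * counit (R := k) (r.right i) =
          counit (R := k) h := by
        have := congrArg (counit (R := k)) (sum_counit_smul r)
        simpa using this
      rw [smashMul_tmul r, map_sum, smashCounit_tmul, smashCounit_tmul, ← key]
      simp only [smashCounit_tmul, map_mul, hε, Bialgebra.counit_mul, Finset.mul_sum,
        Finset.sum_mul]
      exact Finset.sum_congr rfl fun i _ => by ring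

variable [IsModuleAlgebra k H Λ]

theorem smashDiag_mulLeft {ι : Type*} {h : H} (r : Repr k h ι) (b : Λ) (w : Λ ⊗[k] H) :
    smashDiag k Λ H h ((LinearMap.mulLeft k b).rTensor H w) =
      ∑ i ∈ r.index, (LinearMap.mulLeft k (r.left i • b)).rTensor H
        (smashDiag k Λ H (r.right i) w) := by
  induction w using TensorProduct.induction_on with
  | zero => simp
  | add s t hs ht => simp only [map_add, hs, ht, Finset.sum_add_distrib]
  | tmul c e =>
    rw [LinearMap.rTensor_tmul, LinearMap.mulLeft_apply, smashDiag_tmul r]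
    let al : H →ₗ[k] Module.End k Λ := (Algebra.lsmul k k Λ : H →ₐ[k] Module.End k Λ).toLinearMap
    have key := congrArg (TensorProduct.map
        (LinearMap.mul' k Λ ∘ₗ TensorProduct.map (al.flip b) (al.flip c)) (LinearMap.mulRight k e) ∘ₗ
          (TensorProduct.assoc k H H H).symm)
      (sum_tmul_tmul_eq r (fun i => ℛ k (r.left i)) (fun i => ℛ k (r.right i)))
    simp only [map_sum, LinearMap.comp_apply, LinearEquiv.coe_coe, TensorProduct.assoc_symm_tmul,
      TensorProduct.map_tmul, LinearMap.mul'_apply, LinearMap.mulRight_apply] at key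
    refine Eq.trans (Finset.sum_congr rfl fun i _ => ?_) (key.trans
      (Finset.sum_congr rfl fun i _ => ?_))
    · rw [IsModuleAlgebra.smul_mul_repr (ℛ k (r.left i)), TensorProduct.sum_tmul]
      rfl
    · rw [smashDiag_tmul (ℛ k (r.right i)), map_sum]
      rfl

theorem smashMul_assoc (x y z : Λ ⊗[k] H) :
    smashMul k Λ H (smashMul k Λ H x y) z = smashMul k Λ H x (smashMul k Λ H y z) := by
  induction x using TensorProduct.induction_on with
  | zero => simp
  | add s t hs ht => simp only [map_add, LinearMap.add_apply, hs, ht]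
  | tmul a h =>
    induction y using TensorProduct.induction_on with
    | zero => simp
    | add s t hs ht => simp only [map_add, LinearMap.add_apply, hs, ht]
    | tmul b g =>
      let r := ℛ k h
      rw [smashMul_tmul r, smashMul_apply a, smashMul_apply b, smashDiag_mulLeft r, map_sum,
        map_sum, LinearMap.sum_apply]
      refine Finset.sum_congr rfl fun i _ => ?_
      rw [smashMul_apply, map_mul, LinearMap.mulLeft_mul, LinearMap.rTensor_comp]
      rfl

theorem smashMul_one_right (z : Λ ⊗[k] H) : smashMul k Λ H z (1 ⊗ₜ 1) = z := by
  induction z using TensorProduct.induction_on with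
  | zero => simp
  | add s t hs ht => simp only [map_add, LinearMap.add_apply, hs, ht]
  | tmul a h =>
    let r := ℛ k h
    rw [smashMul_tmul r]
    simp only [IsModuleAlgebra.smul_one' (k := k), mul_smul_comm, mul_one, TensorProduct.smul_tmul]
    rw [← TensorProduct.tmul_sum, sum_counit_smul r]

instance : Ring (SmashProduct k Λ H) where
  __ := (inferInstance : AddCommGroup (SmashProduct k Λ H))
  mul x y := smashMul k Λ H x y
  one := (1 : Λ) ⊗ₜ[k] (1 : H)
  mul_assoc := smashMul_assoc
  one_mul := smashMul_one_left
  mul_one := smashMul_one_right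
  zero_mul := LinearMap.map_zero₂ (smashMul k Λ H)
  mul_zero x := map_zero (smashMul k Λ H x)
  left_distrib x := map_add (smashMul k Λ H x)
  right_distrib := LinearMap.map_add₂ (smashMul k Λ H)

instance : Algebra k (SmashProduct k Λ H) :=
  Algebra.ofModule (fun c x y => LinearMap.map_smul₂ (smashMul k Λ H) c x y)
    (fun c x y => map_smul (smashMul k Λ H x) c y)

/-- The augmentation `a # h ↦ ε(a) ε(h)` of the smash product. -/
def smashAug (ε : Λ →ₐ[k] k) (hε : ∀ (h : H) (x : Λ), ε (h • x) = counit h * ε x) :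
    SmashProduct k Λ H →ₐ[k] k :=
  AlgHom.ofLinearMap (smashCounit (k := k) (Λ := Λ) (H := H) ε)
    ((smashCounit_tmul ε 1 1).trans (by simp)) (smashCounit_mul ε hε)

end Smash

section Connected

open Coalgebra

variable {k : Type*} [Field k] {Λ : Type*} [Ring Λ] [Algebra k Λ] (𝒜 : ℕ → Submodule k Λ)
  [GradedAlgebra 𝒜]

/-- A graded algebra is connected if its component of degree `0` is `k`. -/
def IsConnectedGrading : Prop := Function.Bijective (algebraMap k (𝒜 0))

/-- The augmentation `Λ → Λ₀ = k` of a connected graded algebra. -/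
def connectedAug (h : IsConnectedGrading 𝒜) : Λ →ₐ[k] k :=
  ((AlgEquiv.ofBijective (Algebra.ofId k (𝒜 0)) h).symm : 𝒜 0 →ₐ[k] k).comp
    { GradedRing.projZeroRingHom' 𝒜 with
      commutes' := fun c => GradedRing.projZeroRingHom'_apply_coe 𝒜 (algebraMap k (𝒜 0) c) }

theorem algebraMap_connectedAug (h : IsConnectedGrading 𝒜) (x : Λ) :
    algebraMap k Λ (connectedAug 𝒜 h x) = (DirectSum.decompose 𝒜 x 0 : Λ) := by
  have := (AlgEquiv.ofBijective (Algebra.ofId k (𝒜 0)) h).apply_symm_apply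
    (GradedRing.projZeroRingHom' 𝒜 x)
  exact congrArg Subtype.val this

theorem connectedAug_smul {H : Type*} [Ring H] [Bialgebra k H] [Module H Λ] [IsScalarTower k H Λ]
    [IsModuleAlgebra k H Λ] (hc : IsConnectedGrading 𝒜)
    (hst : ∀ (n : ℕ) (h : H), ∀ x ∈ 𝒜 n, h • x ∈ 𝒜 n) (h : H) (x : Λ) :
    connectedAug 𝒜 hc (h • x) = counit h * connectedAug 𝒜 hc x := by
  have hinj : Function.Injective (algebraMap k Λ) := fun a b hab => hc.1 (Subtype.ext hab)
  apply hinj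
  have hdec : (DirectSum.decompose 𝒜 (h • x) 0 : Λ) = h • (DirectSum.decompose 𝒜 x 0 : Λ) := by
    induction x using DirectSum.Decomposition.inductionOn 𝒜 with
    | zero => simp
    | add s t hs ht => simp [smul_add, DirectSum.decompose_add, hs, ht]
    | @homogeneous i m =>
      by_cases hi : i = 0
      · subst hi
        rw [DirectSum.decompose_of_mem_same 𝒜 (hst 0 h _ m.2),
          DirectSum.decompose_of_mem_same 𝒜 m.2]
      · rw [DirectSum.decompose_of_mem_ne 𝒜 (hst i h _ m.2) hi,
          DirectSum.decompose_of_mem_ne 𝒜 m.2 hi, smul_zero]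
  rw [map_mul, algebraMap_connectedAug, algebraMap_connectedAug, hdec,
    ← algebraMap_connectedAug 𝒜 hc, Algebra.algebraMap_eq_smul_one, smul_comm,
    IsModuleAlgebra.smul_one' (k := k), Algebra.algebraMap_eq_smul_one, smul_mul_assoc, one_mul,
    smul_smul, smul_smul, mul_comm]

end Connected

section Hopf

open Coalgebra

variable (k : Type*) [Field k] (H : Type*) [Ring H] [HopfAlgebra k H]

open Classical in
/-- The inverse `S̄` of the antipode `S` (and `0` if `S` is not bijective). -/
def antipodeInv : H →ₗ[k] H :=
  if h : Function.Bijective (HopfAlgebra.antipode k : H →ₗ[k] H) then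
    (LinearEquiv.ofBijective _ h).symm.toLinearMap
  else 0

variable {k H} {Λ : Type*} [Ring Λ] [Algebra k Λ] [Module H Λ] [IsScalarTower k H Λ]
  [IsModuleAlgebra k H Λ]

/-- The action of `H` on the Yoneda ring `E(Λ)`: it is induced by `(h · f)(x) = f(S̄(h) · x)` for
`f ∈ Ωⁿ(Λ)` and `x ∈ Λ₊^{⊗n}`, where `H` acts diagonally on `Λ₊^{⊗n}`. -/
def yonedaAct (ε : Λ →ₐ[k] k)
    (hε : ∀ (h : H) (x : Λ), ε (h • x) = counit h * ε x) (h : H) :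
    YonedaRing ε →ₗ[k] YonedaRing ε :=
  cohRingPullback (augAct_actsOnMul ε hε) (antipodeInv k H h)

end Hopf

section YetterDrinfeld

open Coalgebra

variable {k : Type*} [Field k] {H : Type*} [Ring H] [Bialgebra k H] {Λ : Type*} [Ring Λ]
  [Algebra k Λ] [Module H Λ] [IsScalarTower k H Λ]

/-- The algebra `Λ`, with its `H`-action and a coaction `ρ : Λ → H ⊗ Λ`,
`ρ(x) = x₍₋₁₎ ⊗ x₍₀₎`, is an algebra in the category of left-left Yetter-Drinfeld modules over `H`:
`ρ` is coassociative and counital, it satisfies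
`h₍₁₎x₍₋₁₎ ⊗ h₍₂₎ · x₍₀₎ = (h₍₁₎ · x)₍₋₁₎h₍₂₎ ⊗ (h₍₁₎ · x)₍₀₎`, and the multiplication and the unit of
`Λ` are `H`-linear and `H`-colinear. -/
structure IsYetterDrinfeldAlgebra (ρ : Λ →ₗ[k] H ⊗[k] Λ) : Prop extends
    IsModuleAlgebra k H Λ where
  coassoc : TensorProduct.assoc k H H Λ ∘ₗ comul.rTensor Λ ∘ₗ ρ = ρ.lTensor H ∘ₗ ρ
  counit_left : TensorProduct.lid k Λ ∘ₗ (counit (R := k) (A := H)).rTensor Λ ∘ₗ ρ = LinearMap.id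
  compat : ∀ (h : H) (x : Λ),
    TensorProduct.map₂ (LinearMap.mul k H)
        (Algebra.lsmul k k Λ : H →ₐ[k] Module.End k Λ).toLinearMap (comul h) (ρ x) =
      TensorProduct.lift
        ((LinearMap.rTensorHom Λ ∘ₗ (LinearMap.mul k H).flip).flip ∘ₗ ρ ∘ₗ
          (Algebra.lsmul k k Λ : H →ₐ[k] Module.End k Λ).toLinearMap.flip x) (comul h)
  mul_colinear : ∀ x y : Λ, ρ (x * y) = ρ x * ρ y
  one_colinear : ρ 1 = 1

end YetterDrinfeld

end BarCohomology

end

open BarCohomology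

/-! The isomorphism is restriction along `a ↦ a # 1`, an algebra map, hence compatible with
differentials and products of bar cochains. What must be proved, in each degree, is that it is
injective on cohomology and that its image is the space of invariants.

Semisimplicity gives an element `t` with `ε(t) = 1` and `ht = ε(h)t = th`, by splitting the
augmentation ideal off `H`. It is used three times. First, `Δ(t)(h ⊗ 1) = Δ(t)(1 ⊗ S(h))` forces `H`
to be spanned by the left tensor factors of `Δ(t)`, so `H` is finite dimensional, and it also makes
`S` injective. Second, `S(t₍₁₎) ⊗ t₍₂₎` is a Casimir element (`IsNormalizedIntegral.casimir`), that
is, a separability idempotent. Cut down by `1 - t`, it yields homotopies in the bar complex showing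
that every cocycle on `Λ # H` is cohomologous to one that vanishes as soon as an argument lies in
`H₊` (`IsCasimir.exists_vanishesOn`). Third, pulling back along `t` averages a cochain on `Λ` into
an invariant one.

A cocycle vanishing on `H₊` is relative: elements of `H` move from the right of one argument to the
left of the next. Relative cochains on `Λ # H` correspond bijectively to cochains on `Λ`, by
restriction and `inflate`. A relative cocycle restricts to an invariant cocycle, and on invariant
cochains inflation commutes with the differential (`d_inflate`).

Hence restricted classes are invariant. An invariant class is represented by an averaged, invariant
cocycle, whose inflation is a preimage. If the restriction of a relative cocycle is a coboundary,
averaging a primitive and inflating it shows that the cocycle is itself a coboundary. Since `S⁻¹` is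
surjective and preserves the counit, invariance under the pullbacks agrees with invariance under the
action in the statement. -/

noncomputable section

namespace BarCohomology

/-! ### Integrals in semisimple Hopf algebras, finite dimension, and bijectivity of the antipode. -/

section Integral

open Coalgebra HopfAlgebra

/-- A semisimple ring contains a left integral for every ring homomorphism to a field. -/
theorem exists_left_integral {R K : Type*} [Ring R] [IsSemisimpleRing R] [Field K] (ε : R →+* K) :
    ∃ t : R, ε t = 1 ∧ ∀ h, ε h = 0 → h * t = 0 := by
  -- Split `1 = u + t` along `ker ε ⊕ N`. For `h` in `ker ε`, the product `ht` lies in `ker ε`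
  -- because `ε` is multiplicative and in `N` because `N` is a left ideal.
  obtain ⟨N, hN⟩ := exists_isCompl (RingHom.ker ε)
  obtain ⟨u, hu, t, ht, hut⟩ := Submodule.mem_sup.1
    (hN.sup_eq_top ▸ Submodule.mem_top : (1 : R) ∈ RingHom.ker ε ⊔ N)
  rw [RingHom.mem_ker] at hu
  refine ⟨t, by simpa [hu] using congrArg ε hut, fun h hh => ?_⟩
  have : h * t ∈ RingHom.ker ε ⊓ N :=
    ⟨RingHom.mem_ker.2 (by rw [map_mul, hh, zero_mul]), N.smul_mem h ht⟩
  rwa [hN.inf_eq_bot] at this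

variable (k : Type*) [Field k] {H : Type*} [Ring H]

/-- A normalized two-sided integral of a Hopf algebra. -/
structure IsNormalizedIntegral [Bialgebra k H] (t : H) : Prop where
  counit_eq : counit (R := k) t = 1
  mul_left : ∀ h : H, h * t = counit (R := k) h • t
  mul_right : ∀ h : H, t * h = counit (R := k) h • t

/-- Semisimplicity passes to the opposite ring, so there is a left integral `t` and a right integral
`s`, both of counit `1`. Computing `st` in two ways gives `s = t`. -/
theorem exists_isNormalizedIntegral [Bialgebra k H] [IsSemisimpleRing H] :
    ∃ t : H, IsNormalizedIntegral k t := by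
  let ε : H →+* k := (Bialgebra.counitAlgHom k H : H →+* k)
  have hε : ∀ h, ε h = counit (R := k) h := fun _ => rfl
  let ε' : Hᵐᵒᵖ →+* k := ε.fromOpposite fun _ _ => mul_comm _ _
  have hε' : ∀ h, ε' (MulOpposite.op h) = counit (R := k) h := fun _ => rfl
  obtain ⟨t, ht, htl⟩ := exists_left_integral ε
  obtain ⟨s', hs, hsr⟩ := exists_left_integral ε'
  obtain ⟨s, rfl⟩ := MulOpposite.op_surjective s'
  have hl : ∀ h : H, h * t = counit (R := k) h • t := fun h => by
    have := htl (h - algebraMap k H (counit (R := k) h)) (by simp [hε])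
    rwa [sub_mul, sub_eq_zero, ← Algebra.smul_def] at this
  have hr : ∀ h : H, s * h = counit (R := k) h • s := fun h => by
    have := congrArg MulOpposite.unop
      (hsr (MulOpposite.op (h - algebraMap k H (counit (R := k) h))) (by rw [hε']; simp))
    rw [MulOpposite.unop_mul, MulOpposite.unop_op, MulOpposite.unop_op, MulOpposite.unop_zero,
      mul_sub, sub_eq_zero] at this
    rw [this, ← Algebra.commutes, Algebra.smul_def]
  have hst : s = t := by
    have h1 := hl s
    rw [hr t, ← hε' s, hs, ← hε, ht, one_smul, one_smul] at h1
    exact h1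
  exact ⟨t, ht, hl, hst ▸ hr⟩

variable {k} [HopfAlgebra k H] {t : H}

theorem sum_counit_smul_left {H : Type*} [AddCommGroup H] [Module k H] [Coalgebra k H]
    {ι : Type*} {h : H} (r : Repr k h ι) :
    ∑ i ∈ r.index, counit (R := k) (r.right i) • r.left i = h := by
  have := congrArg (TensorProduct.rid k H) (sum_tmul_counit_eq r)
  simpa only [map_sum, TensorProduct.rid_tmul, one_smul] using this

theorem sum_comul_mul_antipode {ι : Type*} {h : H} (r : Repr k h ι) :
    ∑ i ∈ r.index, comul (R := k) (r.left i) * (1 ⊗ₜ antipode k (r.right i)) = h ⊗ₜ[k] 1 := by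
  have key := congrArg ((LinearMap.mul' k H ∘ₗ (antipode k).lTensor H).lTensor H)
    (sum_tmul_tmul_eq r (fun i => ℛ k (r.left i)) (fun i => ℛ k (r.right i)))
  simp only [map_sum, LinearMap.lTensor_tmul, LinearMap.comp_apply, LinearMap.mul'_apply] at key
  refine (Finset.sum_congr rfl fun i _ => ?_).trans (key.trans ?_)
  · rw [← (ℛ k (r.left i)).eq, Finset.sum_mul]
    simp
  · simp only [← TensorProduct.tmul_sum, sum_mul_antipode_eq_smul, ← TensorProduct.smul_tmul]
    rw [← TensorProduct.sum_tmul]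
    congr 1
    exact sum_counit_smul_left r

/-- Write `h ⊗ 1 = Δ(h₍₁₎)(1 ⊗ S(h₍₂₎))` and absorb `Δ(t)Δ(h₍₁₎) = Δ(th₍₁₎) = ε(h₍₁₎)Δ(t)`. -/
theorem IsNormalizedIntegral.comul_mul_tmul_one (ht : IsNormalizedIntegral k t) (h : H) :
    comul (R := k) t * (h ⊗ₜ 1) = comul (R := k) t * (1 ⊗ₜ antipode k h) := by
  let r := ℛ k h
  rw [← sum_comul_mul_antipode r, Finset.mul_sum]
  simp only [← mul_assoc, ← Bialgebra.comul_mul, ht.mul_right, map_smul, smul_mul_assoc]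
  conv_rhs => rw [← sum_counit_smul r]
  simp only [map_sum, map_smul, TensorProduct.tmul_sum, Finset.mul_sum, TensorProduct.tmul_smul,
    mul_smul_comm]

/-- Insert `1 ⊗ h = h₍₁₎S(h₍₂₎) ⊗ h₍₃₎` on the right-hand side. Since `S` reverses products,
`S(h₍₂₎)S(t₍₁₎) ⊗ t₍₂₎h₍₃₎` comes from `Δ(th₍₂₎) = ε(h₍₂₎)Δ(t)`, and the counit collapses the rest
to `hS(t₍₁₎) ⊗ t₍₂₎`. -/
theorem IsNormalizedIntegral.casimir (ht : IsNormalizedIntegral k t) {ι : Type*} (s : Repr k t ι)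
    (h : H) : ∑ i ∈ s.index, (h * antipode k (s.left i)) ⊗ₜ[k] s.right i =
      ∑ i ∈ s.index, antipode k (s.left i) ⊗ₜ[k] (s.right i * h) := by
  let r := ℛ k h
  let φ : H ⊗[k] H →ₗ[k] H ⊗[k] H := ∑ i ∈ s.index,
    TensorProduct.map (LinearMap.mulRight k (antipode k (s.left i))) (LinearMap.mulLeft k (s.right i))
  have hφ : ∀ x y, φ (x ⊗ₜ y) = ∑ i ∈ s.index,
      (x * antipode k (s.left i)) ⊗ₜ[k] (s.right i * y) := fun x y => by
    simp [φ]
  have key := congrArg (φ ∘ₗ (LinearMap.mul' k H ∘ₗ (antipode k).lTensor H).rTensor H ∘ₗ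
      (TensorProduct.assoc k H H H).symm)
    (sum_tmul_tmul_eq r (fun i => ℛ k (r.left i)) (fun i => ℛ k (r.right i)))
  simp only [map_sum, LinearMap.comp_apply, LinearEquiv.coe_coe, TensorProduct.assoc_symm_tmul,
    LinearMap.rTensor_tmul, LinearMap.lTensor_tmul, LinearMap.mul'_apply] at key
  have hR : ∀ i, ∑ j ∈ (ℛ k (r.right i)).index, φ ((r.left i * antipode k
      ((ℛ k (r.right i)).left j)) ⊗ₜ (ℛ k (r.right i)).right j) =
      counit (R := k) (r.right i) • φ (r.left i ⊗ₜ 1) := fun i => by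
    have h1 := congrArg (TensorProduct.map (LinearMap.mulLeft k (r.left i) ∘ₗ antipode k)
      LinearMap.id) (ht.mul_right (r.right i) ▸ Bialgebra.comul_mul (R := k) t (r.right i))
    rw [← s.eq, ← (ℛ k (r.right i)).eq, map_smul, map_smul, ← s.eq, Finset.sum_mul_sum] at h1
    simp only [map_sum, Algebra.TensorProduct.tmul_mul_tmul, TensorProduct.map_tmul,
      LinearMap.comp_apply, LinearMap.mulLeft_apply, antipode_mul_antidistrib, LinearMap.id_apply,
      ← mul_assoc] at h1
    rw [Finset.sum_comm] at h1
    simp only [hφ, mul_one]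
    exact h1.symm
  have hL : ∑ i ∈ r.index, ∑ j ∈ (ℛ k (r.left i)).index, φ (((ℛ k (r.left i)).left j * antipode k
      ((ℛ k (r.left i)).right j)) ⊗ₜ r.right i) = φ (1 ⊗ₜ h) := by
    simp only [← map_sum, ← TensorProduct.sum_tmul, sum_mul_antipode_eq_smul,
      TensorProduct.smul_tmul]
    rw [← TensorProduct.tmul_sum, sum_counit_smul]
  rw [hL, Finset.sum_congr rfl fun i _ => hR i] at key
  simp only [← map_smul, ← map_sum, TensorProduct.smul_tmul'] at key
  rw [← TensorProduct.sum_tmul] at key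
  rw [sum_counit_smul_left r, hφ, hφ] at key
  simpa using key.symm

/-- The span of the left tensor factors of `Δ(t)`. -/
def leftFactors (k : Type*) [Field k] {H : Type*} [Ring H] [HopfAlgebra k H] (t : H) :
    Submodule k H :=
  LinearMap.range (LinearMap.applyₗ (comul (R := k) t) ∘ₗ
    (TensorProduct.rid k H).toLinearMap.compRight k ∘ₗ LinearMap.lTensorHom H :
      Module.Dual k H →ₗ[k] H)

theorem mem_leftFactors {x : H} : x ∈ leftFactors k t ↔ ∃ φ : Module.Dual k H,
    TensorProduct.rid k H (φ.lTensor H (comul (R := k) t)) = x := Iff.rfl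

instance finiteDimensional_leftFactors : FiniteDimensional k (leftFactors k t) := by
  let s := ℛ k t
  have := FiniteDimensional.span_of_finite k (s.index.finite_toSet.image s.left)
  refine Submodule.finiteDimensional_of_le (S₂ := Submodule.span k (s.left '' s.index)) ?_
  · rintro x ⟨φ, rfl⟩
    change TensorProduct.rid k H (φ.lTensor H (comul (R := k) t)) ∈ _
    rw [← s.eq, map_sum, map_sum]
    refine Submodule.sum_mem _ fun i hi => ?_
    rw [LinearMap.lTensor_tmul, TensorProduct.rid_tmul]
    exact Submodule.smul_mem _ _ (Submodule.subset_span ⟨i, hi, rfl⟩)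

/-- Right multiplication on the left factor of `Δ(t)` can be traded for multiplication by `S(h)` on
the right factor, where the functional absorbs it. -/
theorem IsNormalizedIntegral.mul_mem_leftFactors (ht : IsNormalizedIntegral k t) {x : H}
    (hx : x ∈ leftFactors k t) (h : H) : x * h ∈ leftFactors k t := by
  obtain ⟨φ, rfl⟩ := mem_leftFactors.1 hx
  refine mem_leftFactors.2 ⟨φ ∘ₗ LinearMap.mulRight k (antipode k h), ?_⟩
  have h1 := congrArg (fun z => TensorProduct.rid k H (φ.lTensor H z)) (ht.comul_mul_tmul_one h)
  let s := ℛ k t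
  rw [← s.eq] at h1 ⊢
  simp only [Finset.sum_mul, Algebra.TensorProduct.tmul_mul_tmul, map_sum, LinearMap.lTensor_tmul,
    TensorProduct.rid_tmul, mul_one] at h1
  simp only [map_sum, LinearMap.lTensor_tmul, TensorProduct.rid_tmul, Finset.sum_mul,
    LinearMap.comp_apply, LinearMap.mulRight_apply, smul_mul_assoc, h1]

/-- The antipode axiom gives `1 = ε(t)1 = t₍₁₎S(t₍₂₎)`, and the span of the left factors is closed
under right multiplication. -/
theorem IsNormalizedIntegral.one_mem_leftFactors (ht : IsNormalizedIntegral k t) :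
    (1 : H) ∈ leftFactors k t := by
  classical
  let b := Module.Basis.ofVectorSpace k H
  have h1 := mul_antipode_lTensor_comul_apply (R := k) t
  rw [ht.counit_eq, map_one] at h1
  -- With the right factors expanded in a basis, each left coefficient is the image of `Δ(t)` under
  -- a coordinate functional, hence a left factor.
  obtain ⟨c, hc⟩ := TensorProduct.eq_repr_basis_right b (comul (R := k) t)
  rw [← h1, ← hc, Finsupp.sum, map_sum, map_sum]
  refine Submodule.sum_mem _ fun i _ => ?_
  refine ht.mul_mem_leftFactors (mem_leftFactors.2 ⟨b.coord i, ?_⟩) _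
  rw [← TensorProduct.equivFinsuppOfBasisRight_apply, ← hc, Finsupp.sum, map_sum,
    Finsupp.finsetSum_apply]
  simp only [TensorProduct.equivFinsuppOfBasisRight_apply_tmul_apply, Module.Basis.repr_self]
  rw [Finset.sum_eq_single i]
  · simp
  · intro j _ hj
    simp [hj]
  · intro hi
    simpa using hi

theorem IsNormalizedIntegral.leftFactors_eq_top (ht : IsNormalizedIntegral k t) :
    leftFactors k t = ⊤ :=
  eq_top_iff.2 fun x _ => one_mul x ▸ ht.mul_mem_leftFactors ht.one_mem_leftFactors x

theorem IsNormalizedIntegral.finiteDimensional (ht : IsNormalizedIntegral k t) :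
    FiniteDimensional k H := by
  have : FiniteDimensional k (⊤ : Submodule k H) :=
    ht.leftFactors_eq_top ▸ finiteDimensional_leftFactors
  exact Module.Finite.of_surjective (⊤ : Submodule k H).subtype fun x => ⟨⟨x, trivial⟩, rfl⟩

theorem IsNormalizedIntegral.antipode_bijective (ht : IsNormalizedIntegral k t) :
    Function.Bijective (antipode k : H →ₗ[k] H) := by
  have := ht.finiteDimensional
  have hinj : Function.Injective (antipode k : H →ₗ[k] H) := by
    rw [injective_iff_map_eq_zero]
    intro h hh
    -- If `S(h) = 0` then `Δ(t)(h ⊗ 1) = 0`. A functional `φ` with `(id ⊗ φ)Δ(t) = 1` turns this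
    -- into `h = 0`.
    obtain ⟨φ, hφ⟩ := mem_leftFactors.1 ht.one_mem_leftFactors
    have h1 := congrArg (fun z => TensorProduct.rid k H (φ.lTensor H z)) (ht.comul_mul_tmul_one h)
    let s := ℛ k t
    rw [← s.eq] at h1 hφ
    simp only [hh, TensorProduct.tmul_zero, mul_zero, map_zero, Finset.sum_mul,
      Algebra.TensorProduct.tmul_mul_tmul, map_sum, LinearMap.lTensor_tmul,
      TensorProduct.rid_tmul, mul_one] at h1 hφ
    rw [← one_mul h, ← hφ, Finset.sum_mul]
    simpa only [smul_mul_assoc] using h1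
  exact ⟨hinj, LinearMap.injective_iff_surjective.1 hinj⟩

theorem counit_antipodeInv (hS : Function.Bijective (antipode k : H →ₗ[k] H)) (h : H) :
    counit (R := k) (antipodeInv k H h) = counit (R := k) h := by
  have : antipode k (antipodeInv k H h) = h := by
    rw [antipodeInv, dif_pos hS]
    exact (LinearEquiv.ofBijective _ hS).apply_symm_apply h
  conv_rhs => rw [← this, counit_antipode]

theorem antipodeInv_surjective (hS : Function.Bijective (antipode k : H →ₗ[k] H)) :
    Function.Surjective (antipodeInv k H) := by
  rw [antipodeInv, dif_pos hS]
  exact (LinearEquiv.ofBijective _ hS).symm.surjective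

end Integral

/-! ### Bar cochains with coefficients, dimension shifting, and normalization by a Casimir element.
-/

section Coefficients

set_option linter.unusedSectionVars false

universe u v w

variable {k : Type u} [Field k] {I : Type v} [NonUnitalRing I] [Module k I]
  [IsScalarTower k I I] [SMulCommClass k I I] {M : Type w} [AddCommGroup M] [Module k M]

/-- `(coeffContract j f)(λ₀, …, λₙ) = f(λ₀, …, λⱼλⱼ₊₁, …, λₙ)` for cochains with values in `M`. -/
def coeffContract {n : ℕ} (j : Fin n) : MultilinearMap k (fun _ : Fin n => I) M →ₗ[k]
    MultilinearMap k (fun _ : Fin (n + 1) => I) M where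
  toFun f :=
    { toFun := fun v => f (Fin.contractNth j.castSucc (· * ·) v)
      map_update_add' := fun v i x y => by
        obtain ⟨p, φ, h⟩ := contractNth_update k j v i
        simp only [h, map_add, f.map_update_add]
      map_update_smul' := fun v i c x => by
        obtain ⟨p, φ, h⟩ := contractNth_update k j v i
        simp only [h, map_smul, f.map_update_smul] }
  map_add' _ _ := rfl
  map_smul' _ _ := rfl

/-- The part of the bar differential that does not involve the action on the coefficients. -/
def innerD (n : ℕ) : MultilinearMap k (fun _ : Fin n => I) M →ₗ[k]
    MultilinearMap k (fun _ : Fin (n + 1) => I) M :=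
  ∑ i : Fin n, (-1 : k) ^ ((i : ℕ) + 1) • coeffContract i

theorem innerD_apply {n : ℕ} (f : MultilinearMap k (fun _ : Fin n => I) M) (v : Fin (n + 1) → I) :
    innerD n f v = ∑ i : Fin n, (-1 : k) ^ ((i : ℕ) + 1) •
      f (Fin.contractNth i.castSucc (· * ·) v) := by
  simp only [innerD, LinearMap.sum_apply, sum_apply, LinearMap.smul_apply,
    smul_apply]
  rfl

theorem innerD_eq_d {n : ℕ} (f : Cochain k I n) : innerD n f = d k n f :=
  MultilinearMap.ext fun v => by simp [innerD_apply, d_apply]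

theorem innerD_zero (f : MultilinearMap k (fun _ : Fin 0 => I) M) : innerD 0 f = 0 := by
  simp [innerD]

theorem innerD_cons {n : ℕ} (f : MultilinearMap k (fun _ : Fin (n + 1) => I) M) (x y : I)
    (v : Fin n → I) :
    innerD (n + 1) f (Fin.cons x (Fin.cons y v : Fin (n + 1) → I) : Fin (n + 2) → I) =
      -(f (Fin.cons (x * y) v : Fin (n + 1) → I)) -
        innerD n (f.curryLeft x) (Fin.cons y v : Fin (n + 1) → I) := by
  rw [innerD_apply, Fin.sum_univ_succ, innerD_apply, sub_eq_add_neg, ← Finset.sum_neg_distrib]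
  congr 1
  · simp only [Fin.val_zero, zero_add, pow_one, neg_smul, one_smul]
    congr 2
    funext i
    refine Fin.cases ?_ (fun i => ?_) i <;> simp [Fin.contractNth]
  · refine Finset.sum_congr rfl fun i _ => ?_
    rw [Fin.val_succ, pow_succ, mul_neg_one, neg_smul, MultilinearMap.curryLeft_apply]
    congr 3
    funext q
    refine Fin.cases ?_ (fun q => ?_) q
    · simp [Fin.contractNth]
    · simp [Fin.contractNth]

theorem innerD_compMultilinearMap {N : Type*} [AddCommGroup N] [Module k N] {n : ℕ} (g : M →ₗ[k] N)
    (f : MultilinearMap k (fun _ : Fin n => I) M) :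
    innerD n (g.compMultilinearMap f) = g.compMultilinearMap (innerD n f) :=
  MultilinearMap.ext fun v => by simp [innerD_apply]

/-- `(x₀, …, xₙ) ↦ θ(f(x₁, …, xₙ))(x₀)`. -/
def prependSlot {N : Type*} [AddCommGroup N] [Module k N] (θ : N →ₗ[k] I →ₗ[k] M) (n : ℕ) :
    MultilinearMap k (fun _ : Fin n => I) N →ₗ[k]
      MultilinearMap k (fun _ : Fin (n + 1) => I) M where
  toFun f := LinearMap.uncurryLeft
    { toFun := fun x => (θ.flip x).compMultilinearMap f
      map_add' := fun _ _ => by ext; simp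
      map_smul' := fun _ _ => by ext; simp }
  map_add' _ _ := by ext; simp
  map_smul' _ _ := by ext; simp

theorem prependSlot_cons {N : Type*} [AddCommGroup N] [Module k N] (θ : N →ₗ[k] I →ₗ[k] M) {n : ℕ}
    (f : MultilinearMap k (fun _ : Fin n => I) N) (x : I) (v : Fin n → I) :
    prependSlot θ n f (Fin.cons x v : Fin (n + 1) → I) = θ (f v) x := by
  simp [prependSlot]

theorem prependSlot_curryLeft {N : Type*} [AddCommGroup N] [Module k N] (θ : N →ₗ[k] I →ₗ[k] M)
    {n : ℕ} (f : MultilinearMap k (fun _ : Fin n => I) N) (x : I) :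
    (prependSlot θ n f).curryLeft x = (θ.flip x).compMultilinearMap f :=
  MultilinearMap.ext fun v => prependSlot_cons θ f x v

variable (act : I →ₗ[k] M →ₗ[k] M)

/-- The differential of the bar complex with coefficients in `M`, for the given left action on `M`
and the zero right action. -/
def coeffD (n : ℕ) : MultilinearMap k (fun _ : Fin n => I) M →ₗ[k]
    MultilinearMap k (fun _ : Fin (n + 1) => I) M :=
  prependSlot act.flip n + innerD n

theorem coeffD_cons {n : ℕ} (f : MultilinearMap k (fun _ : Fin n => I) M) (x : I) (v : Fin n → I) :
    coeffD act n f (Fin.cons x v : Fin (n + 1) → I) =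
      act x (f v) + innerD n f (Fin.cons x v : Fin (n + 1) → I) := by
  rw [coeffD, LinearMap.add_apply, add_apply, prependSlot_cons]
  rfl

theorem coeffD_cons_cons {n : ℕ} (f : MultilinearMap k (fun _ : Fin (n + 1) => I) M) (x y : I)
    (v : Fin n → I) :
    coeffD act (n + 1) f (Fin.cons x (Fin.cons y v : Fin (n + 1) → I) : Fin (n + 2) → I) =
      act x (f (Fin.cons y v : Fin (n + 1) → I)) - f (Fin.cons (x * y) v : Fin (n + 1) → I) -
        innerD n (f.curryLeft x) (Fin.cons y v : Fin (n + 1) → I) := by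
  rw [coeffD_cons, innerD_cons]
  abel

theorem exists_eq_cons {n : ℕ} (v : Fin (n + 1) → I) :
    ∃ (x : I) (w : Fin n → I), v = (Fin.cons x w : Fin (n + 1) → I) :=
  ⟨v 0, Fin.tail v, (Fin.cons_self_tail v).symm⟩

/-- The action `(y φ)(x) = φ(xy) - x φ(y)` on linear maps, for which prepending a slot
anticommutes with the differentials. -/
def homAct : I →ₗ[k] (I →ₗ[k] M) →ₗ[k] (I →ₗ[k] M) :=
  LinearMap.mk₂ k (fun y φ => φ ∘ₗ LinearMap.mulRight k y - act.flip (φ y))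
    (fun y y' φ => by ext; simp [mul_add]; abel)
    (fun c y φ => by ext; simp [smul_sub, mul_smul_comm])
    (fun y φ φ' => by ext; simp; abel)
    (fun c y φ => by ext; simp [smul_sub])

theorem homAct_apply (x y : I) (φ : I →ₗ[k] M) :
    homAct act y φ x = φ (x * y) - act x (φ y) := by
  simp [homAct]

variable {act}

/-- This makes `I →ₗ[k] M` an admissible coefficient module again, so that inductions on the degree
may change the coefficients. -/
theorem homAct_mul (hact : ∀ x y m, act (x * y) m = act x (act y m)) (x y : I) (φ : I →ₗ[k] M) :
    homAct act (x * y) φ = homAct act x (homAct act y φ) := by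
  ext z
  simp only [homAct_apply, map_sub, hact, mul_assoc]
  abel

/-- Dimension shifting: a cochain with values in maps `I → M` is a cochain of one degree more with
values in `M`. A general equivariant `θ` is allowed because both the identity and the inclusion of
`relHom` are needed. -/
theorem coeffD_prependSlot {N : Type*} [AddCommGroup N] [Module k N] {actN : I →ₗ[k] N →ₗ[k] N}
    (θ : N →ₗ[k] I →ₗ[k] M) (hθ : ∀ y m, θ (actN y m) = homAct act y (θ m)) {n : ℕ}
    (f : MultilinearMap k (fun _ : Fin n => I) N) :
    coeffD act (n + 1) (prependSlot θ n f) = -prependSlot θ (n + 1) (coeffD actN n f) := by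
  ext w
  obtain ⟨x, w, rfl⟩ := exists_eq_cons w
  obtain ⟨y, v, rfl⟩ := exists_eq_cons w
  rw [coeffD_cons_cons, prependSlot_cons, prependSlot_cons, prependSlot_curryLeft,
    innerD_compMultilinearMap, neg_apply, prependSlot_cons, coeffD_cons, map_add,
    LinearMap.add_apply, hθ, homAct_apply, LinearMap.compMultilinearMap_apply,
    LinearMap.flip_apply]
  abel

variable (k I M) in
/-- Moving the first slot of a cochain into the coefficients. -/
def absorbSlot {n : ℕ} (f : MultilinearMap k (fun _ : Fin (n + 1) => I) M) :
    MultilinearMap k (fun _ : Fin n => I) (I →ₗ[k] M) where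
  toFun v :=
    { toFun := fun x => f (Fin.cons x v : Fin (n + 1) → I)
      map_add' := fun x y => f.cons_add v x y
      map_smul' := fun c x => f.cons_smul v c x }
  map_update_add' v i x y := by
    ext z
    exact (f.curryLeft z).map_update_add v i x y
  map_update_smul' v i c x := by
    ext z
    exact (f.curryLeft z).map_update_smul v i c x

theorem absorbSlot_apply {n : ℕ} (f : MultilinearMap k (fun _ : Fin (n + 1) => I) M)
    (v : Fin n → I) (x : I) : absorbSlot k I M f v x = f (Fin.cons x v : Fin (n + 1) → I) := rfl

/-- A cochain of positive degree is `prependSlot` of its `absorbSlot`, and the signs of two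
differentials cancel, so the degree drops by one. The module `I →ₗ[k] M` must stay in the universe
of `M`, which is why that universe contains the one of `I`. -/
theorem coeffD_coeffD {M : Type (max v w)} [AddCommGroup M] [Module k M]
    {act : I →ₗ[k] M →ₗ[k] M} (hact : ∀ x y m, act (x * y) m = act x (act y m)) {n : ℕ}
    (f : MultilinearMap k (fun _ : Fin n => I) M) : coeffD act (n + 1) (coeffD act n f) = 0 := by
  induction n generalizing M with
  | zero =>
    ext w
    obtain ⟨x, w, rfl⟩ := exists_eq_cons w
    obtain ⟨y, v, rfl⟩ := exists_eq_cons w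
    have h0 : ((coeffD act 0 f).curryLeft x) = MultilinearMap.constOfIsEmpty k _ (act x (f v)) := by
      ext w
      obtain rfl := Subsingleton.elim w v
      rw [MultilinearMap.curryLeft_apply, coeffD_cons, innerD_zero]
      simp
    rw [coeffD_cons_cons, h0, innerD_zero, coeffD_cons, coeffD_cons, innerD_zero, hact]
    simp
  | succ n ih =>
    have hf : f = prependSlot LinearMap.id n (absorbSlot k I M f) := by
      ext w
      obtain ⟨x, v, rfl⟩ := exists_eq_cons w
      rw [prependSlot_cons]
      rfl
    rw [hf, coeffD_prependSlot (actN := homAct act) _ fun _ _ => rfl, map_neg,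
      coeffD_prependSlot (actN := homAct act) _ fun _ _ => rfl, ih (homAct_mul hact)]
    simp

/-- A cochain vanishes on `J` if it is zero as soon as one of its arguments lies in `J`. -/
def VanishesOn {n : ℕ} (J : Set I) (f : MultilinearMap k (fun _ : Fin n => I) M) : Prop :=
  ∀ v i, v i ∈ J → f v = 0

variable (act) in
/-- The linear maps `φ : I → M` with `φ(J) = 0` and `φ(hx) = h φ(x)` for `h ∈ J`. -/
def relHom (J : Set I) : Submodule k (I →ₗ[k] M) where
  carrier := {φ | (∀ h ∈ J, φ h = 0) ∧ ∀ h ∈ J, ∀ x, φ (h * x) = act h (φ x)}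
  add_mem' := fun hf hg =>
    ⟨fun h hh => by simp [hf.1 h hh, hg.1 h hh], fun h hh x => by simp [hf.2 h hh, hg.2 h hh]⟩
  zero_mem' := ⟨fun _ _ => rfl, fun _ _ _ => by simp⟩
  smul_mem' := fun c f hf =>
    ⟨fun h hh => by simp [hf.1 h hh], fun h hh x => by simp [hf.2 h hh]⟩

/-- The two defining conditions support each other: `J`-linearity of `φ` makes `homAct act y φ`
vanish on `J`. -/
theorem homAct_mem_relHom (hact : ∀ x y m, act (x * y) m = act x (act y m)) {J : Set I}
    {φ : I →ₗ[k] M} (hφ : φ ∈ relHom act J) (y : I) : homAct act y φ ∈ relHom act J := by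
  refine ⟨fun h hh => ?_, fun h hh x => ?_⟩
  · rw [homAct_apply, hφ.2 h hh, sub_self]
  · rw [homAct_apply, homAct_apply, mul_assoc, hφ.2 h hh, hact, map_sub]

/-- The action `homAct` on `relHom`. -/
def relHomAct (hact : ∀ x y m, act (x * y) m = act x (act y m)) (J : Set I) :
    I →ₗ[k] relHom act J →ₗ[k] relHom act J :=
  LinearMap.mk₂ k (fun y φ => ⟨homAct act y φ.1, homAct_mem_relHom hact φ.2 y⟩)
    (fun _ _ _ => Subtype.ext (by simp)) (fun _ _ _ => Subtype.ext (by simp))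
    (fun _ _ _ => Subtype.ext (by simp)) (fun _ _ _ => Subtype.ext (by simp))

/-- The family `cᵢ ⊗ dᵢ` is a Casimir element for `J`, and `∑ cᵢdᵢ` is a unit for `J`. -/
structure IsCasimir (k : Type*) [Field k] {I : Type*} [NonUnitalRing I] [Module k I] (J : Set I)
    {ι : Type*} (s : Finset ι) (c d : ι → I) : Prop where
  comm : ∀ h ∈ J, ∑ i ∈ s, (h * c i) ⊗ₜ[k] d i = ∑ i ∈ s, c i ⊗ₜ[k] (d i * h)
  unit_mem : ∑ i ∈ s, c i * d i ∈ J
  mul_unit : ∀ h ∈ J, h * ∑ i ∈ s, c i * d i = h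
  unit_mul : ∀ h ∈ J, (∑ i ∈ s, c i * d i) * h = h

theorem IsCasimir.exists_vanish_first {J : Set I} {ι : Type*} {s : Finset ι} {c d : ι → I}
    (hJ : IsCasimir k J s c d) (hact : ∀ x y m, act (x * y) m = act x (act y m)) {n : ℕ}
    (f : MultilinearMap k (fun _ : Fin (n + 1) => I) M) (hf : coeffD act (n + 1) f = 0) :
    ∃ g : MultilinearMap k (fun _ : Fin n => I) M,
      ∀ h ∈ J, ∀ v, (f - coeffD act n g) (Fin.cons h v : Fin (n + 1) → I) = 0 := by
  obtain ⟨e, he⟩ : ∃ e, e = ∑ i ∈ s, c i * d i := ⟨_, rfl⟩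
  -- Let `e = ∑ cᵢdᵢ`. At `(h, v)` the differential of `∑ cᵢf(dᵢ, -)` is only `e f(h, v)`, since `e`
  -- need not act as the identity on `M`; for trivial coefficients it acts as zero. The terms `-f(e,
  -- -) + e f(e, -)` supply the missing `(1 - e) f(h, v)`.
  refine ⟨∑ i ∈ s, (act (c i)).compMultilinearMap (f.curryLeft (d i)) - f.curryLeft e +
    (act e).compMultilinearMap (f.curryLeft e), fun h hh v => ?_⟩
  have hd : ∀ x, innerD n (f.curryLeft x) (Fin.cons h v : Fin (n + 1) → I) =
      act x (f (Fin.cons h v : Fin (n + 1) → I)) - f (Fin.cons (x * h) v : Fin (n + 1) → I) :=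
    fun x => by
      have := coeffD_cons_cons act f x h v
      rw [hf, zero_apply, eq_comm, sub_eq_zero] at this
      exact this.symm
  have hcomm : ∑ i ∈ s, act h (act (c i) (f (Fin.cons (d i) v : Fin (n + 1) → I))) =
      ∑ i ∈ s, act (c i) (f (Fin.cons (d i * h) v : Fin (n + 1) → I)) := by
    have := congrArg (TensorProduct.lift (act.compl₂ (absorbSlot k I M f v))) (hJ.comm h hh)
    simpa only [map_sum, TensorProduct.lift.tmul, LinearMap.compl₂_apply, absorbSlot_apply, hact]
      using this
  have hhe : ∀ m, act h (act e m) = act h m := fun m => by rw [← hact, he, hJ.mul_unit h hh]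
  have hsum : ∑ i ∈ s, act (c i) (act (d i) (f (Fin.cons h v : Fin (n + 1) → I))) =
      act e (f (Fin.cons h v : Fin (n + 1) → I)) := by
    simp only [← hact, ← map_sum, ← LinearMap.sum_apply, he]
  have heh : e * h = h := he ▸ hJ.unit_mul h hh
  have hee : ∀ m, act e (act e m) = act e m := fun m => by
    rw [← hact, he, hJ.mul_unit _ hJ.unit_mem]
  rw [sub_apply, sub_eq_zero, coeffD_cons]
  simp only [map_add, map_sub, map_sum, add_apply, sub_apply,
    sum_apply, LinearMap.compMultilinearMap_apply, MultilinearMap.curryLeft_apply,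
    innerD_compMultilinearMap, hd, heh, Finset.sum_sub_distrib, hhe, hcomm, hsum, hee]
  abel

/-- Arguments are normalized one at a time. Once the first slot vanishes on `J`, it is moved into
the coefficients and the induction hypothesis treats the remaining slots. Taking coefficients in
`relHom` keeps the later corrections from spoiling the first slot. -/
theorem IsCasimir.exists_vanishesOn {M : Type (max v w)} [AddCommGroup M] [Module k M]
    {act : I →ₗ[k] M →ₗ[k] M} {J : Set I} {ι : Type*} {s : Finset ι} {c d : ι → I}
    (hJ : IsCasimir k J s c d) (hact : ∀ x y m, act (x * y) m = act x (act y m)) {n : ℕ}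
    (f : MultilinearMap k (fun _ : Fin (n + 1) => I) M) (hf : coeffD act (n + 1) f = 0) :
    ∃ g : MultilinearMap k (fun _ : Fin n => I) M, VanishesOn J (f - coeffD act n g) := by
  induction n generalizing M with
  | zero =>
    obtain ⟨g, hg⟩ := hJ.exists_vanish_first hact f hf
    refine ⟨g, fun v i hi => ?_⟩
    obtain ⟨x, v, rfl⟩ := exists_eq_cons v
    obtain rfl : i = 0 := Fin.fin_one_eq_zero i
    exact hg x hi v
  | succ n ih =>
    obtain ⟨g, hg⟩ := hJ.exists_vanish_first hact f hf
    have hf1 : coeffD act (n + 2) (f - coeffD act (n + 1) g) = 0 := by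
      rw [map_sub, hf, coeffD_coeffD hact, sub_zero]
    generalize hF : f - coeffD act (n + 1) g = F at hg hf1
    -- With `h ∈ J` in the first slot, all but two terms of the cocycle identity vanish, leaving
    -- `F(hx, v) = h F(x, v)`.
    have hmem : ∀ v, absorbSlot k I M F v ∈ relHom act J := fun v => by
      refine ⟨fun h hh => hg h hh v, fun h hh x => ?_⟩
      have h1 := coeffD_cons_cons act F h x v
      have h2 : F.curryLeft h = 0 := MultilinearMap.ext fun v => hg h hh v
      rw [hf1, h2, map_zero, zero_apply, zero_apply, sub_zero,
        eq_comm, sub_eq_zero] at h1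
      exact h1.symm
    let F' : MultilinearMap k (fun _ : Fin (n + 1) => I) (relHom act J) :=
      (absorbSlot k I M F).codRestrict _ hmem
    let θ := (relHom act J).subtype
    have hθ : ∀ y m, θ (relHomAct hact J y m) = homAct act y (θ m) := fun _ _ => rfl
    have hFF' : F = prependSlot θ (n + 1) F' := by
      ext w
      obtain ⟨x, v, rfl⟩ := exists_eq_cons w
      rw [prependSlot_cons]
      rfl
    have hF' : coeffD (relHomAct hact J) (n + 1) F' = 0 := by
      ext v x
      have h1 := coeffD_prependSlot θ hθ F'
      rw [← hFF', hf1] at h1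
      have h2 := congrArg (fun z => z (Fin.cons x v : Fin (n + 3) → I)) h1
      rw [zero_apply, neg_apply, prependSlot_cons, eq_comm,
        neg_eq_zero] at h2
      exact h2
    obtain ⟨g', hg'⟩ := ih (fun x y m => Subtype.ext (homAct_mul hact x y m.1)) F' hF'
    refine ⟨g - prependSlot θ n g', ?_⟩
    have hrw : f - coeffD act (n + 1) (g - prependSlot θ n g') =
        prependSlot θ (n + 1) (F' - coeffD (relHomAct hact J) n g') := by
      rw [map_sub, coeffD_prependSlot θ hθ, map_sub (prependSlot θ (n + 1)), ← hFF', ← hF]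
      abel
    rw [hrw]
    intro v i hi
    obtain ⟨x, v, rfl⟩ := exists_eq_cons v
    rw [prependSlot_cons]
    refine Fin.cases (fun hi => ?_) (fun i hi => ?_) i hi
    · exact (Subtype.prop ((F' - coeffD (relHomAct hact J) n g') v)).1 x hi
    · rw [hg' v i hi, map_zero, LinearMap.zero_apply]

/-- If `J` has a Casimir element, then every cocycle of positive degree is cohomologous to one that
vanishes on `J`. -/
theorem IsCasimir.exists_vanishesOn_cochain {J : Set I} {ι : Type*} {s : Finset ι} {c d' : ι → I}
    (hJ : IsCasimir k J s c d') {n : ℕ} (f : Cochain k I (n + 1)) (hf : d k (n + 1) f = 0) :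
    ∃ g : Cochain k I n, VanishesOn J (f - d k n g) := by
  -- The coefficients are `k` with zero action, lifted to a universe that also accommodates the maps
  -- out of `I` used in the induction.
  let e : ULift.{v} k ≃ₗ[k] k := ULift.moduleEquiv
  have hd : ∀ {m : ℕ} (F : MultilinearMap k (fun _ : Fin m => I) (ULift.{v} k)),
      coeffD (0 : I →ₗ[k] ULift.{v} k →ₗ[k] ULift.{v} k) m F = innerD m F := fun F => by
    ext v
    obtain ⟨x, v, rfl⟩ := exists_eq_cons v
    rw [coeffD_cons]
    simp
  obtain ⟨g, hg⟩ := hJ.exists_vanishesOn (act := (0 : I →ₗ[k] ULift.{v} k →ₗ[k] ULift.{v} k))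
    (fun _ _ _ => rfl) (e.symm.toLinearMap.compMultilinearMap f)
    (by rw [hd, innerD_compMultilinearMap, innerD_eq_d, hf]; ext; simp)
  refine ⟨e.toLinearMap.compMultilinearMap g, fun v i hi => ?_⟩
  have := congrArg e (hg v i hi)
  rw [hd, sub_apply, map_sub, map_zero] at this
  rw [← innerD_eq_d, innerD_compMultilinearMap, sub_apply]
  exact this

end Coefficients

/-! ### The diagonal action on cochains as a right action. -/

section Pullback

open Coalgebra

variable {k : Type*} [Field k] {H : Type*} [Ring H] [Bialgebra k H] {I : Type*} [NonUnitalRing I]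
  [Module k I] (act : H →ₗ[k] I →ₗ[k] I)

theorem pullback_zero (h : H) (f : Cochain k I 0) :
    pullback act 0 h f = counit (R := k) h • f := by
  ext v
  rw [pullback_apply, diagonalAct, LinearMap.comp_apply, iterComul, LinearMap.smulRight_apply,
    map_smul, LinearMap.smul_apply, map_smul, PiTensorProduct.map₂_tprod_tprod,
    PiTensorProduct.lift.tprod, smul_apply]
  congr 2
  exact Subsingleton.elim _ _

/-- The product of two representations of comultiplications. -/
def reprMul {h g : H} {ι κ : Type*} (r : Repr k h ι) (s : Repr k g κ) : Repr k (h * g) (ι × κ) where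
  index := r.index ×ˢ s.index
  left i := r.left i.1 * s.left i.2
  right i := r.right i.1 * s.right i.2
  eq := by
    rw [Bialgebra.comul_mul, ← r.eq, ← s.eq, Finset.sum_mul_sum, Finset.sum_product]
    simp only [Algebra.TensorProduct.tmul_mul_tmul]

variable {act}

/-- Precomposition reverses products. The induction peels off the first argument, using that `Δ` is
multiplicative. -/
theorem pullback_mul_apply (hact : ∀ g h x, act (g * h) x = act g (act h x)) {n : ℕ} (g h : H)
    (f : Cochain k I n) : pullback act n (h * g) f = pullback act n g (pullback act n h f) := by
  induction n generalizing g h with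
  | zero =>
    ext v
    simp only [pullback_zero, Bialgebra.counit_mul, smul_apply, smul_eq_mul]
    ring
  | succ n ih =>
    ext w
    obtain ⟨x, v, rfl⟩ := exists_eq_cons w
    let r := ℛ k h
    let s := ℛ k g
    rw [pullback_cons act (reprMul r s), pullback_cons act s]
    simp only [pullback_curryLeft act r, map_sum, sum_apply, ← ih]
    rw [Finset.sum_comm]
    simp only [reprMul, Finset.sum_product, hact]

theorem pullback_one (hact : ∀ x, act 1 x = x) {n : ℕ} (f : Cochain k I n) :
    pullback act n 1 f = f := by
  induction n with
  | zero => rw [pullback_zero, Bialgebra.counit_one, one_smul]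
  | succ n ih =>
    ext w
    obtain ⟨x, v, rfl⟩ := exists_eq_cons w
    let r : Repr k (1 : H) Unit := ⟨{()}, fun _ => 1, fun _ => 1, by
      simp [Algebra.TensorProduct.one_def]⟩
    rw [pullback_cons act r]
    simp [r, ih, hact]

end Pullback

/-! ### The augmentation ideal of the smash product, `(Λ₊ ⊗ H) ⊕ (1 # H₊)`. -/

section SmashAug

open Coalgebra

variable {k : Type*} [Field k] {Λ : Type*} [Ring Λ] [Algebra k Λ] {H : Type*} [Ring H]

/-- The element `a # h` of the smash product. -/
def smk [Algebra k H] (a : Λ) (h : H) : SmashProduct k Λ H := a ⊗ₜ[k] h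

theorem smk_add_right [Algebra k H] (a : Λ) (h g : H) :
    (smk a (h + g) : SmashProduct k Λ H) = smk a h + smk a g := TensorProduct.tmul_add _ _ _

theorem smk_sub_right [Algebra k H] (a : Λ) (h g : H) :
    (smk a (h - g) : SmashProduct k Λ H) = smk a h - smk a g := TensorProduct.tmul_sub _ _ _

theorem smk_smul_right [Algebra k H] (c : k) (a : Λ) (h : H) :
    (smk a (c • h) : SmashProduct k Λ H) = c • smk a h := TensorProduct.tmul_smul _ _ _

theorem smk_sub_left [Algebra k H] (a b : Λ) (h : H) :
    (smk (a - b) h : SmashProduct k Λ H) = smk a h - smk b h := TensorProduct.sub_tmul _ _ _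

theorem smk_smul_left [Algebra k H] (c : k) (a : Λ) (h : H) :
    (smk (c • a) h : SmashProduct k Λ H) = c • smk a h := TensorProduct.smul_tmul' _ _ _

variable [Bialgebra k H] [Module H Λ] [IsScalarTower k H Λ] [IsModuleAlgebra k H Λ]

theorem smk_mul_smk {ι : Type*} {h : H} (r : Repr k h ι) (a b : Λ) (g : H) :
    (smk a h : SmashProduct k Λ H) * smk b g =
      ∑ i ∈ r.index, smk (a * (r.left i • b)) (r.right i * g) :=
  smashMul_tmul r a b g

theorem smk_one_mul_smk (a b : Λ) (g : H) :
    (smk a 1 : SmashProduct k Λ H) * smk b g = smk (a * b) g := by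
  let r : Repr k (1 : H) Unit := ⟨{()}, fun _ => 1, fun _ => 1, by
    simp [Algebra.TensorProduct.one_def]⟩
  rw [smk_mul_smk r]
  simp [r]

theorem smk_mul_one_smk (a : Λ) (h g : H) :
    (smk a h : SmashProduct k Λ H) * smk 1 g = smk a (h * g) := by
  let r := ℛ k h
  rw [smk_mul_smk r]
  simp only [IsModuleAlgebra.smul_one' (k := k), mul_smul_comm, mul_one]
  change ∑ i ∈ r.index, (counit (R := k) (r.left i) • a) ⊗ₜ[k] (r.right i * g) = a ⊗ₜ[k] (h * g)
  simp only [TensorProduct.smul_tmul, ← smul_mul_assoc]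
  rw [← TensorProduct.tmul_sum, ← Finset.sum_mul, sum_counit_smul r]

variable (ε : Λ →ₐ[k] k) (hε : ∀ (h : H) (x : Λ), ε (h • x) = counit h * ε x)

theorem smashAug_smk (a : Λ) (h : H) : smashAug ε hε (smk a h) = ε a * counit (R := k) h := rfl

theorem smk_one_one : (smk 1 1 : SmashProduct k Λ H) = 1 := rfl

/-- The inclusion `a ↦ a # 1` of the augmentation ideals. -/
def augInl : augIdeal ε →ₗ[k] augIdeal (smashAug ε hε) where
  toFun a := ⟨smk a.1 1, by rw [mem_augIdeal, smashAug_smk, mem_augIdeal.1 a.2, zero_mul]⟩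
  map_add' _ _ := Subtype.ext (TensorProduct.add_tmul _ _ _)
  map_smul' _ _ := Subtype.ext (TensorProduct.smul_tmul' _ _ _)

theorem augInl_mul (a b : augIdeal ε) :
    augInl ε hε (a * b) = augInl ε hε a * augInl ε hε b :=
  Subtype.ext (smk_one_mul_smk _ _ _).symm

/-- The map `h ↦ 1 # (h - ε(h)1)` to the augmentation ideal. -/
def augInr : H →ₗ[k] augIdeal (smashAug ε hε) where
  toFun h := ⟨smk 1 (h - algebraMap k H (counit (R := k) h)), by
    rw [mem_augIdeal, smashAug_smk]; simp⟩
  map_add' h g := Subtype.ext (by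
    change (smk 1 _ : SmashProduct k Λ H) = smk 1 _ + smk 1 _
    rw [← smk_add_right, map_add, map_add, add_sub_add_comm])
  map_smul' c h := Subtype.ext (by
    change (smk 1 _ : SmashProduct k Λ H) = c • smk 1 _
    rw [← smk_smul_right, map_smul, smul_sub, smul_eq_mul, map_mul, ← Algebra.smul_def])

theorem augInr_val (h : H) : (augInr ε hε h).1 = smk 1 h - counit (R := k) h • 1 := by
  change smk 1 (h - algebraMap k H (counit (R := k) h)) = _
  rw [smk_sub_right, Algebra.algebraMap_eq_smul_one, smk_smul_right, smk_one_one]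

theorem augInr_one : augInr ε hε 1 = 0 :=
  Subtype.ext (by
    rw [augInr_val, smk_one_one, Bialgebra.counit_one, one_smul, sub_self]
    rfl)

/-- Left multiplication by `1 # h` on the augmentation ideal. -/
def augLeft (h : H) : augIdeal (smashAug ε hε) →ₗ[k] augIdeal (smashAug ε hε) where
  toFun x := ⟨smk 1 h * x.1, by rw [mem_augIdeal, map_mul, mem_augIdeal.1 x.2, mul_zero]⟩
  map_add' _ _ := Subtype.ext (mul_add _ _ _)
  map_smul' _ _ := Subtype.ext (mul_smul_comm _ _ _)

/-- Right multiplication by `1 # h` on the augmentation ideal. -/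
def augRight (h : H) : augIdeal (smashAug ε hε) →ₗ[k] augIdeal (smashAug ε hε) where
  toFun x := ⟨x.1 * smk 1 h, by rw [mem_augIdeal, map_mul, mem_augIdeal.1 x.2, zero_mul]⟩
  map_add' _ _ := Subtype.ext (add_mul _ _ _)
  map_smul' _ _ := Subtype.ext (smul_mul_assoc _ _ _)

theorem augLeft_augRight (h g : H) (x : augIdeal (smashAug ε hε)) :
    augLeft ε hε h (augRight ε hε g x) = augRight ε hε g (augLeft ε hε h x) :=
  Subtype.ext (mul_assoc _ _ _).symm

theorem augRight_augRight (h g : H) (x : augIdeal (smashAug ε hε)) :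
    augRight ε hε h (augRight ε hε g x) = augRight ε hε (g * h) x :=
  Subtype.ext (by
    change (x.1 * smk 1 g) * smk 1 h = x.1 * smk 1 (g * h)
    rw [mul_assoc, smk_mul_one_smk])

theorem augRight_one (x : augIdeal (smashAug ε hε)) : augRight ε hε 1 x = x :=
  Subtype.ext (mul_one x.1)

theorem augInr_mul (h : H) (x : augIdeal (smashAug ε hε)) :
    augInr ε hε h * x = augLeft ε hε h x - counit (R := k) h • x :=
  Subtype.ext (by
    change (augInr ε hε h).1 * x.1 = smk 1 h * x.1 - counit (R := k) h • x.1
    rw [augInr_val, sub_mul, smul_mul_assoc, one_mul])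

theorem mul_augInr (h : H) (x : augIdeal (smashAug ε hε)) :
    x * augInr ε hε h = augRight ε hε h x - counit (R := k) h • x :=
  Subtype.ext (by
    change x.1 * (augInr ε hε h).1 = x.1 * smk 1 h - counit (R := k) h • x.1
    rw [augInr_val, mul_sub, mul_smul_comm, mul_one])

theorem augLeft_augInr (h g : H) : augLeft ε hε h (augInr ε hε g) =
    augInr ε hε (h * g - counit (R := k) g • h) :=
  Subtype.ext (by
    change smk 1 h * (augInr ε hε g).1 = _
    rw [map_sub, map_smul]
    change _ = (augInr ε hε (h * g)).1 - counit (R := k) g • (augInr ε hε h).1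
    rw [augInr_val, augInr_val, augInr_val, mul_sub, smk_mul_one_smk, mul_smul_comm, mul_one,
      Bialgebra.counit_mul, smul_sub, smul_smul, mul_comm (counit (R := k) g)]
    abel)

theorem augRight_augInr (h g : H) : augRight ε hε h (augInr ε hε g) =
    augInr ε hε (g * h - counit (R := k) g • h) :=
  Subtype.ext (by
    change (augInr ε hε g).1 * smk 1 h = _
    rw [map_sub, map_smul]
    change _ = (augInr ε hε (g * h)).1 - counit (R := k) g • (augInr ε hε h).1
    rw [augInr_val, augInr_val, augInr_val, sub_mul, smk_mul_one_smk, smul_mul_assoc, one_mul,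
      Bialgebra.counit_mul, smul_sub, smul_smul]
    abel)

/-- The commutation rule of the smash product: `h` passes `a`, acting by `h₍₁₎` and leaving `h₍₂₎`
on the right. -/
theorem augLeft_augInl {ι : Type*} {h : H} (r : Repr k h ι) (a : augIdeal ε) :
    augLeft ε hε h (augInl ε hε a) =
      ∑ i ∈ r.index, augRight ε hε (r.right i) (augInl ε hε (augAct ε hε (r.left i) a)) :=
  Subtype.ext (by
    rw [AddSubmonoidClass.coe_finsetSum]
    change smk 1 h * smk a.1 1 = ∑ i ∈ r.index, smk (r.left i • a.1) 1 * smk 1 (r.right i)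
    rw [smk_mul_smk r]
    simp only [smk_mul_one_smk, one_mul, mul_one])

/-- The projection `a ↦ a - ε(a)1` to the augmentation ideal. -/
def augProj : Λ →ₗ[k] augIdeal ε where
  toFun a := ⟨a - algebraMap k Λ (ε a), by rw [mem_augIdeal]; simp⟩
  map_add' a b := Subtype.ext (by
    change a + b - algebraMap k Λ (ε (a + b)) = (_ - _) + (_ - _)
    rw [map_add, map_add, add_sub_add_comm])
  map_smul' c a := Subtype.ext (by
    change c • a - algebraMap k Λ (ε (c • a)) = c • (_ - _)
    rw [map_smul, smul_sub, smul_eq_mul, map_mul, ← Algebra.smul_def])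

theorem augProj_val (a : augIdeal ε) : augProj ε a.1 = a :=
  Subtype.ext (by
    change a.1 - algebraMap k Λ (ε a.1) = a.1
    rw [mem_augIdeal.1 a.2, map_zero, sub_zero])

theorem augProj_one : augProj ε 1 = 0 :=
  Subtype.ext (by
    change 1 - algebraMap k Λ (ε 1) = 0
    simp)

/-- The projection of the augmentation ideal of `Λ # H` to `Λ₊ ⊗ H`. -/
def augSplit : augIdeal (smashAug ε hε) →ₗ[k] augIdeal ε ⊗[k] H :=
  (augProj ε).rTensor H ∘ₗ (augIdeal (smashAug ε hε)).toSubmodule.subtype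

theorem augSplit_augRight_augInl (h : H) (a : augIdeal ε) :
    augSplit ε hε (augRight ε hε h (augInl ε hε a)) = a ⊗ₜ h := by
  change (augProj ε).rTensor H (smk a.1 1 * smk 1 h : SmashProduct k Λ H) = _
  rw [smk_mul_one_smk, one_mul]
  change (augProj ε a.1) ⊗ₜ[k] h = _
  rw [augProj_val]

theorem augSplit_augInr (h : H) : augSplit ε hε (augInr ε hε h) = 0 := by
  change (augProj ε 1) ⊗ₜ[k] _ = _
  rw [augProj_one, TensorProduct.zero_tmul]

variable {ε hε}

/-- The augmentation ideal of `Λ # H` is spanned by the `a # h` with `a ∈ Λ₊` and by `H₊`. -/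
theorem smashAug_induction {P : augIdeal (smashAug ε hε) → Prop}
    (inl : ∀ h a, P (augRight ε hε h (augInl ε hε a))) (inr : ∀ h, P (augInr ε hε h))
    (add : ∀ x y, P x → P y → P (x + y)) (x : augIdeal (smashAug ε hε)) : P x := by
  -- The ideal is the image of all of `Λ ⊗ H` under `x ↦ x - ε(x)1`, so pure tensors suffice. There
  -- `a # h` splits according to `a = (a - ε(a)1) + ε(a)1`.
  let π : Λ ⊗[k] H →ₗ[k] augIdeal (smashAug ε hε) := augProj (smashAug ε hε)
  have key : ∀ z : Λ ⊗[k] H, P (π z) := fun z => by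
    induction z using TensorProduct.induction_on with
    | zero =>
      rw [map_zero]
      simpa using inr 0
    | add y z hy hz =>
      rw [map_add]
      exact add _ _ hy hz
    | tmul a h =>
      have : π (smk a h) =
          augRight ε hε h (augInl ε hε (augProj ε a)) + augInr ε hε (ε a • h) := by
        refine Subtype.ext ?_
        change smk a h - algebraMap k _ (smashAug ε hε (smk a h)) =
          smk (a - algebraMap k Λ (ε a)) 1 * smk 1 h + (augInr ε hε (ε a • h)).1
        rw [smashAug_smk, smk_mul_one_smk, one_mul, augInr_val, Algebra.algebraMap_eq_smul_one,
          map_smul, smul_eq_mul]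
        have : (smk (a - algebraMap k Λ (ε a)) h : SmashProduct k Λ H) =
            smk a h - smk 1 (ε a • h) := by
          rw [smk_sub_left, Algebra.algebraMap_eq_smul_one, smk_smul_left, smk_smul_right]
        rw [this]
        abel
      have h2 := add _ _ (inl h (augProj ε a)) (inr (ε a • h))
      rwa [← this] at h2
  exact augProj_val (smashAug ε hε) x ▸ key x.1

end SmashAug

/-! ### Restriction of cochains along linear maps. -/

section Restriction

variable {k : Type*} [Field k] {I I' : Type*} [NonUnitalRing I] [Module k I]
  [NonUnitalRing I'] [Module k I']

/-- The restriction of cochains along a linear map. -/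
def cochainMap (φ : I' →ₗ[k] I) (n : ℕ) : Cochain k I n →ₗ[k] Cochain k I' n where
  toFun f := f.compLinearMap fun _ => φ
  map_add' _ _ := rfl
  map_smul' _ _ := rfl

theorem cochainMap_apply (φ : I' →ₗ[k] I) {n : ℕ} (f : Cochain k I n) (v : Fin n → I') :
    cochainMap φ n f v = f fun i => φ (v i) := rfl

theorem cochainMap_curryLeft (φ : I' →ₗ[k] I) {n : ℕ} (f : Cochain k I (n + 1)) (x : I') :
    (cochainMap φ (n + 1) f).curryLeft x = cochainMap φ n (f.curryLeft (φ x)) := by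
  ext v
  rw [MultilinearMap.curryLeft_apply, cochainMap_apply, cochainMap_apply,
    MultilinearMap.curryLeft_apply]
  congr 1
  funext i
  refine Fin.cases ?_ (fun i => ?_) i <;> simp

theorem cochain_ext_curryLeft {n : ℕ} {f g : Cochain k I (n + 1)}
    (h : ∀ x, f.curryLeft x = g.curryLeft x) : f = g := by
  ext w
  obtain ⟨x, v, rfl⟩ := exists_eq_cons w
  exact congrArg (fun z => z v) (h x)

variable [IsScalarTower k I I] [SMulCommClass k I I] [IsScalarTower k I' I'] [SMulCommClass k I' I']

theorem d_cochainMap (φ : I' →ₗ[k] I) (hφ : ∀ x y, φ (x * y) = φ x * φ y) {n : ℕ}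
    (f : Cochain k I n) : d k n (cochainMap φ n f) = cochainMap φ (n + 1) (d k n f) := by
  ext v
  simp only [d_apply, cochainMap_apply]
  refine Finset.sum_congr rfl fun i _ => ?_
  congr 2
  funext q
  simp only [Fin.contractNth]
  split_ifs
  · rfl
  · exact hφ _ _
  · rfl

end Restriction

/-! ### Relative cochains on the smash product and their correspondence with cochains on `Λ`. -/

section Relative

set_option linter.unusedSectionVars false

open Coalgebra

variable {k : Type*} [Field k] {Λ : Type*} [Ring Λ] [Algebra k Λ] {H : Type*} [Ring H]
  [Bialgebra k H] [Module H Λ] [IsScalarTower k H Λ] [IsModuleAlgebra k H Λ]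
  (ε : Λ →ₐ[k] k) (hε : ∀ (h : H) (x : Λ), ε (h • x) = counit h * ε x)

theorem augAct_mul (g h : H) (x : augIdeal ε) :
    augAct ε hε (g * h) x = augAct ε hε g (augAct ε hε h x) :=
  Subtype.ext (mul_smul g h x.1)

theorem augAct_one (x : augIdeal ε) : augAct ε hε 1 x = x :=
  Subtype.ext (one_smul H x.1)

/-- Left multiplication by `1 # h` in the first slot of a cochain. -/
def firstMul (h : H) : (n : ℕ) → Cochain k (augIdeal (smashAug ε hε)) n →
    Cochain k (augIdeal (smashAug ε hε)) n
  -- With no argument left, `h` acts on the trivial module. For a relative cochain of degree one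
  -- this reads `f(xh) = ε(h) f(x)`.
  | 0, f => counit (R := k) h • f
  | _ + 1, f => (f.curryLeft ∘ₗ augLeft ε hε h).uncurryLeft

theorem firstMul_curryLeft (h : H) {n : ℕ} (f : Cochain k (augIdeal (smashAug ε hε)) (n + 1))
    (x : augIdeal (smashAug ε hε)) :
    (firstMul ε hε h (n + 1) f).curryLeft x = f.curryLeft (augLeft ε hε h x) := by
  ext v
  simp [firstMul]

/-- The cochains on `Λ # H` that vanish if an argument lies in `H₊` and for which elements of `H`
can be moved from the right of an argument to the left of the next one. -/
def IsRelative : (n : ℕ) → Cochain k (augIdeal (smashAug ε hε)) n → Prop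
  | 0, _ => True
  | n + 1, f => (∀ h, f.curryLeft (augInr ε hε h) = 0) ∧ ∀ x, IsRelative n (f.curryLeft x) ∧
      ∀ h, f.curryLeft (augRight ε hε h x) = firstMul ε hε h n (f.curryLeft x)

variable {ε hε}

theorem IsRelative.firstMul {n : ℕ} {f : Cochain k (augIdeal (smashAug ε hε)) n}
    (hf : IsRelative ε hε n f) (h : H) : IsRelative ε hε n (firstMul ε hε h n f) := by
  cases n with
  | zero => trivial
  | succ n =>
    refine ⟨fun g => ?_, fun x => ⟨?_, fun g => ?_⟩⟩
    · rw [firstMul_curryLeft, augLeft_augInr, hf.1]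
    · rw [firstMul_curryLeft]
      exact (hf.2 _).1
    · rw [firstMul_curryLeft, firstMul_curryLeft, augLeft_augRight, (hf.2 _).2]

/-- Moving `h` through a relative cochain reproduces the diagonal action: it passes `a₁`, acting by
`h₍₁₎`, then `h₍₂₎` is handed to the next argument, and so on until the counit absorbs what remains.
-/
theorem IsRelative.cochainMap_firstMul {n : ℕ} {f : Cochain k (augIdeal (smashAug ε hε)) n}
    (hf : IsRelative ε hε n f) (h : H) :
    cochainMap (augInl ε hε) n (BarCohomology.firstMul ε hε h n f) =
      pullback (augAct ε hε) n h (cochainMap (augInl ε hε) n f) := by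
  induction n generalizing h with
  | zero =>
    rw [pullback_zero]
    rfl
  | succ n ih =>
    refine cochain_ext_curryLeft fun a => ?_
    let r := ℛ k h
    rw [cochainMap_curryLeft, firstMul_curryLeft, pullback_curryLeft _ r, augLeft_augInl ε hε r,
      map_sum, map_sum]
    refine Finset.sum_congr rfl fun i _ => ?_
    rw [(hf.2 _).2, ih (hf.2 _).1, cochainMap_curryLeft]

variable (ε hε)

/-- The map `a # h ↦ f(a, h · -)`. -/
def inflateFirst {n : ℕ} : Cochain k (augIdeal ε) (n + 1) →ₗ[k]
    augIdeal (smashAug ε hε) →ₗ[k] Cochain k (augIdeal ε) n where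
  toFun f := TensorProduct.lift ((pullback (augAct ε hε) n).flip ∘ₗ f.curryLeft) ∘ₗ augSplit ε hε
  map_add' f g := by
    rw [← LinearMap.add_comp]
    congr 1
    refine TensorProduct.ext' fun a h => ?_
    exact map_add (pullback (augAct ε hε) n h) (f.curryLeft a) (g.curryLeft a)
  map_smul' c f := by
    rw [RingHom.id_apply, ← LinearMap.smul_comp]
    congr 1
    refine TensorProduct.ext' fun a h => ?_
    exact map_smul (pullback (augAct ε hε) n h) c (f.curryLeft a)

theorem inflateFirst_apply {n : ℕ} (f : Cochain k (augIdeal ε) (n + 1))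
    (x : augIdeal (smashAug ε hε)) : inflateFirst ε hε f x = TensorProduct.lift
      ((pullback (augAct ε hε) n).flip ∘ₗ f.curryLeft) (augSplit ε hε x) := rfl

theorem inflateFirst_augRight_augInl {n : ℕ} (f : Cochain k (augIdeal ε) (n + 1)) (h : H)
    (a : augIdeal ε) : inflateFirst ε hε f (augRight ε hε h (augInl ε hε a)) =
      pullback (augAct ε hε) n h (f.curryLeft a) := by
  rw [inflateFirst_apply, augSplit_augRight_augInl]
  rfl

theorem inflateFirst_augInr {n : ℕ} (f : Cochain k (augIdeal ε) (n + 1)) (h : H) :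
    inflateFirst ε hε f (augInr ε hε h) = 0 := by
  rw [inflateFirst_apply, augSplit_augInr, map_zero]

theorem inflateFirst_augInl {n : ℕ} (f : Cochain k (augIdeal ε) (n + 1)) (a : augIdeal ε) :
    inflateFirst ε hε f (augInl ε hε a) = f.curryLeft a := by
  have := inflateFirst_augRight_augInl ε hε f 1 a
  rwa [augRight_one, pullback_one (augAct_one ε hε)] at this

theorem inflateFirst_augRight {n : ℕ} (f : Cochain k (augIdeal ε) (n + 1)) (h : H)
    (x : augIdeal (smashAug ε hε)) : inflateFirst ε hε f (augRight ε hε h x) =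
      pullback (augAct ε hε) n h (inflateFirst ε hε f x) := by
  induction x using smashAug_induction with
  | inl g a =>
    rw [augRight_augRight, inflateFirst_augRight_augInl, inflateFirst_augRight_augInl,
      pullback_mul_apply (augAct_mul ε hε)]
  | inr g => rw [augRight_augInr, inflateFirst_augInr, inflateFirst_augInr, map_zero]
  | add x y hx hy => rw [map_add, map_add, hx, hy, map_add, map_add]

/-- After `h` has passed the first argument, acting by `h₍₁₎`, the leftover `h₍₂₎` acts on the
remaining ones; together this is the diagonal action on all of them. -/
theorem inflateFirst_augLeft {n : ℕ} (f : Cochain k (augIdeal ε) (n + 1)) (h : H)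
    (x : augIdeal (smashAug ε hε)) : inflateFirst ε hε f (augLeft ε hε h x) =
      inflateFirst ε hε (pullback (augAct ε hε) (n + 1) h f) x := by
  induction x using smashAug_induction with
  | inl g a =>
    let r := ℛ k h
    rw [augLeft_augRight, inflateFirst_augRight, augLeft_augInl ε hε r,
      inflateFirst_augRight_augInl, pullback_curryLeft _ r, map_sum]
    simp only [inflateFirst_augRight_augInl]
  | inr g => rw [augLeft_augInr, inflateFirst_augInr, inflateFirst_augInr]
  | add x y hx hy => rw [map_add, map_add, hx, hy, map_add]

/-- The extension of a cochain from `Λ` to `Λ # H`,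
`(a₁ # h₁, a₂ # h₂, …) ↦ f(a₁, h₁ · (a₂, h₂ · (…)))`. -/
def inflate : (n : ℕ) → Cochain k (augIdeal ε) n →ₗ[k] Cochain k (augIdeal (smashAug ε hε)) n
  | 0 =>
    { toFun := fun f => MultilinearMap.constOfIsEmpty k _ (f 0)
      map_add' := fun _ _ => rfl
      map_smul' := fun _ _ => rfl }
  | n + 1 =>
    { toFun := fun f => (inflate n ∘ₗ inflateFirst ε hε f).uncurryLeft
      map_add' := fun f g => by rw [map_add, LinearMap.comp_add]; rfl
      map_smul' := fun c f => by rw [map_smul, LinearMap.comp_smul]; rfl }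

theorem inflate_curryLeft {n : ℕ} (f : Cochain k (augIdeal ε) (n + 1))
    (x : augIdeal (smashAug ε hε)) :
    (inflate ε hε (n + 1) f).curryLeft x = inflate ε hε n (inflateFirst ε hε f x) := by
  ext v
  simp [inflate]

theorem firstMul_inflate {n : ℕ} (f : Cochain k (augIdeal ε) n) (h : H) :
    firstMul ε hε h n (inflate ε hε n f) = inflate ε hε n (pullback (augAct ε hε) n h f) := by
  cases n with
  | zero =>
    rw [pullback_zero, map_smul]
    rfl
  | succ n =>
    refine cochain_ext_curryLeft fun x => ?_
    rw [firstMul_curryLeft, inflate_curryLeft, inflate_curryLeft, inflateFirst_augLeft]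

theorem isRelative_inflate {n : ℕ} (f : Cochain k (augIdeal ε) n) :
    IsRelative ε hε n (inflate ε hε n f) := by
  induction n with
  | zero => trivial
  | succ n ih =>
    refine ⟨fun h => ?_, fun x => ⟨?_, fun h => ?_⟩⟩
    · rw [inflate_curryLeft, inflateFirst_augInr, map_zero]
    · rw [inflate_curryLeft]
      exact ih _
    · rw [inflate_curryLeft, inflate_curryLeft, inflateFirst_augRight, firstMul_inflate]

theorem cochainMap_inflate {n : ℕ} (f : Cochain k (augIdeal ε) n) :
    cochainMap (augInl ε hε) n (inflate ε hε n f) = f := by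
  induction n with
  | zero =>
    ext v
    obtain rfl := Subsingleton.elim v 0
    rfl
  | succ n ih =>
    refine cochain_ext_curryLeft fun a => ?_
    rw [cochainMap_curryLeft, inflate_curryLeft, inflateFirst_augInl, ih]

variable {ε hε}

/-- With `cochainMap_inflate`, this makes restriction a bijection from relative cochains on `Λ # H`
to all cochains on `Λ`. Relativity determines the values on `(a # h, …)` from those on `(a # 1, …)`.
-/
theorem IsRelative.inflate_cochainMap {n : ℕ} {f : Cochain k (augIdeal (smashAug ε hε)) n}
    (hf : IsRelative ε hε n f) : inflate ε hε n (cochainMap (augInl ε hε) n f) = f := by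
  induction n with
  | zero =>
    ext v
    change f _ = f v
    congr 1
    exact Subsingleton.elim _ _
  | succ n ih =>
    refine cochain_ext_curryLeft fun x => ?_
    induction x using smashAug_induction with
    | inl h a =>
      rw [inflate_curryLeft, inflateFirst_augRight_augInl, cochainMap_curryLeft,
        ← (hf.2 _).1.cochainMap_firstMul, ih ((hf.2 _).1.firstMul h), (hf.2 _).2]
    | inr h => rw [inflate_curryLeft, inflateFirst_augInr, map_zero, hf.1]
    | add x y hx hy => rw [map_add, map_add, hx, hy]

theorem IsRelative.vanishesOn {n : ℕ} {f : Cochain k (augIdeal (smashAug ε hε)) n}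
    (hf : IsRelative ε hε n f) : VanishesOn (Set.range (augInr ε hε)) f := by
  induction n with
  | zero => exact fun _ i => i.elim0
  | succ n ih =>
    intro w i hi
    obtain ⟨x, v, rfl⟩ := exists_eq_cons w
    revert hi
    refine Fin.cases (fun hi => ?_) (fun i hi => ?_) i
    · obtain ⟨h, rfl : _ = x⟩ := hi
      exact congrArg (fun z => z v) (hf.1 h)
    · exact ih (hf.2 x).1 v i hi

theorem d_zero_apply {I : Type*} [NonUnitalRing I] [Module k I] [IsScalarTower k I I]
    [SMulCommClass k I I] (f : Cochain k I 0) : d k 0 f = 0 := by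
  ext v
  simp [d_apply]

/-- All terms of the differential vanish except the one multiplying the first two arguments. What is
left measures the failure of `f` to be invariant. -/
theorem IsRelative.d_augInr_cons {n : ℕ} {f : Cochain k (augIdeal (smashAug ε hε)) n}
    (hf : IsRelative ε hε n f) (h : H) (v : Fin n → augIdeal (smashAug ε hε)) :
    d k n f (Fin.cons (augInr ε hε h) v : Fin (n + 1) → _) =
      counit (R := k) h * f v - BarCohomology.firstMul ε hε h n f v := by
  cases n with
  | zero =>
    rw [d_zero_apply]
    exact (sub_self _).symm
  | succ n =>
    obtain ⟨y, v, rfl⟩ := exists_eq_cons v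
    rw [d_cons, hf.1, map_zero, zero_apply, sub_zero, augInr_mul, ← MultilinearMap.curryLeft_apply,
      ← MultilinearMap.curryLeft_apply, ← MultilinearMap.curryLeft_apply, firstMul_curryLeft,
      map_sub, map_smul, sub_apply, smul_apply, smul_eq_mul, neg_sub]

/-- When the second argument lies in `H₊`, the product with the argument before it cancels the
product with the one after it (or the counit term at the end), since `H` moves across. Later
positions follow by peeling off the first argument. -/
theorem IsRelative.d_eq_zero {n : ℕ} {f : Cochain k (augIdeal (smashAug ε hε)) n}
    (hf : IsRelative ε hε n f) (w : Fin (n + 1) → augIdeal (smashAug ε hε)) (i : Fin n)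
    (hi : w i.succ ∈ Set.range (augInr ε hε)) : d k n f w = 0 := by
  induction n with
  | zero => exact i.elim0
  | succ n ih =>
    obtain ⟨x, w, rfl⟩ := exists_eq_cons w
    obtain ⟨y, v, rfl⟩ := exists_eq_cons w
    rw [d_cons]
    revert hi
    refine Fin.cases (fun hi => ?_) (fun i hi => ?_) i
    · obtain ⟨h, rfl : _ = y⟩ := hi
      rw [(hf.2 x).1.d_augInr_cons, mul_augInr, ← MultilinearMap.curryLeft_apply, map_sub,
        map_smul, (hf.2 x).2, sub_apply, smul_apply, smul_eq_mul]
      ring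
    · rw [hf.vanishesOn (Fin.cons (x * y) v) i.succ hi, ih (hf.2 x).1 _ i hi]
      simp

/-- The two surviving terms of `d f(x, h, v) = 0` say exactly that `h` moves from `x` to `v`.
Constraining `d f` only away from the first argument is what lets the hypothesis descend to
`f.curryLeft x`; it also holds trivially for cocycles. -/
theorem isRelative_of_vanishesOn {n : ℕ} {f : Cochain k (augIdeal (smashAug ε hε)) n}
    (hf : VanishesOn (Set.range (augInr ε hε)) f)
    (hd : ∀ (w : Fin (n + 1) → augIdeal (smashAug ε hε)) (i : Fin n),
      w i.succ ∈ Set.range (augInr ε hε) → d k n f w = 0) : IsRelative ε hε n f := by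
  induction n with
  | zero => trivial
  | succ n ih =>
    have hrel : ∀ x, IsRelative ε hε n (f.curryLeft x) := fun x => by
      refine ih (fun v i hi => hf (Fin.cons x v) i.succ hi) fun w i hi => ?_
      obtain ⟨y, v, rfl⟩ := exists_eq_cons w
      have h1 := d_cons f x y v
      rw [hd _ i.succ hi, hf (Fin.cons (x * y) v) i.succ hi, neg_zero, zero_sub, eq_comm,
        neg_eq_zero] at h1
      exact h1
    refine ⟨fun h => MultilinearMap.ext fun v => hf (Fin.cons _ v) 0 ⟨h, rfl⟩,
      fun x => ⟨hrel x, fun h => MultilinearMap.ext fun v => ?_⟩⟩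
    have h1 := d_cons f x (augInr ε hε h) v
    rw [hd _ 0 ⟨h, rfl⟩, (hrel x).d_augInr_cons, mul_augInr, ← MultilinearMap.curryLeft_apply,
      map_sub, map_smul, sub_apply, smul_apply, smul_eq_mul] at h1
    linear_combination h1

/-- A cocycle that vanishes on `H₊` restricts to an `H`-invariant cocycle on `Λ`. -/
theorem pullback_cochainMap_of_vanishesOn {n : ℕ} {f : Cochain k (augIdeal (smashAug ε hε)) n}
    (hf : VanishesOn (Set.range (augInr ε hε)) f) (hd : d k n f = 0) (h : H) :
    pullback (augAct ε hε) n h (cochainMap (augInl ε hε) n f) =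
      counit (R := k) h • cochainMap (augInl ε hε) n f := by
  have hrel := isRelative_of_vanishesOn hf fun w i _ => by rw [hd, zero_apply]
  rw [← hrel.cochainMap_firstMul, ← map_smul]
  congr 1
  ext v
  have := hrel.d_augInr_cons h v
  rw [hd, zero_apply, eq_comm, sub_eq_zero] at this
  exact this.symm

theorem inflate_cochainMap_of_vanishesOn {n : ℕ} {f : Cochain k (augIdeal (smashAug ε hε)) n}
    (hf : VanishesOn (Set.range (augInr ε hε)) f) (hd : d k n f = 0) :
    inflate ε hε n (cochainMap (augInl ε hε) n f) = f :=
  (isRelative_of_vanishesOn hf fun w i _ => by rw [hd, zero_apply]).inflate_cochainMap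

/-- The extension of invariant cochains commutes with the differentials. -/
theorem d_inflate {n : ℕ} {f : Cochain k (augIdeal ε) n}
    (hf : ∀ h, pullback (augAct ε hε) n h f = counit (R := k) h • f) :
    d k n (inflate ε hε n f) = inflate ε hε (n + 1) (d k n f) := by
  -- In the first slot this is the invariance of `f`; in the later slots it is the relativity of the
  -- inflation.
  have hv : VanishesOn (Set.range (augInr ε hε)) (d k n (inflate ε hε n f)) := fun w i hi => by
    obtain ⟨x, v, rfl⟩ := exists_eq_cons w
    revert hi
    refine Fin.cases (fun hi => ?_) (fun i hi => ?_) i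
    · obtain ⟨h, rfl : _ = x⟩ := hi
      rw [(isRelative_inflate ε hε f).d_augInr_cons, firstMul_inflate, hf, map_smul, smul_apply,
        smul_eq_mul, sub_self]
    · exact (isRelative_inflate ε hε f).d_eq_zero _ i hi
  -- The differential is a cocycle vanishing on `H₊`, so it is the inflation of its own restriction,
  -- and restriction commutes with `d`.
  rw [← inflate_cochainMap_of_vanishesOn hv (d_d _ _), ← d_cochainMap _ (augInl_mul ε hε),
    cochainMap_inflate]

end Relative

/-! ### Maps induced on cohomology algebras. -/

section CohMap

variable {k : Type*} [Field k] {I I' : Type*} [NonUnitalRing I] [Module k I]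
  [NonUnitalRing I'] [Module k I'] [IsScalarTower k I I] [SMulCommClass k I I]
  [IsScalarTower k I' I'] [SMulCommClass k I' I']

theorem coh_mk_eq_mk {n : ℕ} {f g : Cocycle k I n} :
    (Submodule.Quotient.mk f : Coh k I n) = Submodule.Quotient.mk g ↔
      f.1 - g.1 ∈ coboundaries k I n :=
  Submodule.Quotient.eq _

theorem coh_mk_eq_zero {n : ℕ} {f : Cocycle k I n} :
    (Submodule.Quotient.mk f : Coh k I n) = 0 ↔ f.1 ∈ coboundaries k I n :=
  Submodule.Quotient.mk_eq_zero _

variable {φ : I' →ₗ[k] I} (hφ : ∀ x y, φ (x * y) = φ x * φ y)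

/-- The restriction of cocycles along a multiplicative linear map. -/
def cocycleMap (n : ℕ) : Cocycle k I n →ₗ[k] Cocycle k I' n :=
  LinearMap.restrict (p := cocycles k I n) (q := cocycles k I' n) (cochainMap φ n) fun f hf => by
    have hf' : d k n f = 0 := hf
    change d k n (cochainMap φ n f) = 0
    rw [d_cochainMap φ hφ, hf', map_zero]

theorem cocycleMap_val {n : ℕ} (f : Cocycle k I n) :
    (cocycleMap hφ n f).1 = cochainMap φ n f.1 := rfl

include hφ in
theorem cochainMap_mem_coboundaries {n : ℕ} {f : Cochain k I n} (hf : f ∈ coboundaries k I n) :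
    cochainMap φ n f ∈ coboundaries k I' n := by
  match n, f, hf with
  | 0, f, hf =>
    have : f = 0 := hf
    rw [this, map_zero]
    exact zero_mem _
  | n + 1, _, ⟨f', rfl⟩ => exact ⟨cochainMap φ n f', d_cochainMap φ hφ f'⟩

/-- The restriction on cohomology spaces along a multiplicative linear map. -/
def cohMap (n : ℕ) : Coh k I n →ₗ[k] Coh k I' n :=
  Submodule.mapQ _ _ (cocycleMap hφ n) fun _ hf => cochainMap_mem_coboundaries hφ hf

theorem cohMap_mk {n : ℕ} (f : Cocycle k I n) : cohMap hφ n (Submodule.Quotient.mk f) =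
    Submodule.Quotient.mk (cocycleMap hφ n f) := rfl

/-- The restriction on cohomology algebras along a multiplicative linear map. -/
def cohRingMap : CohRing k I →ₐ[k] CohRing k I' :=
  DirectSum.toAlgebra k (Coh k I) (fun n => DirectSum.lof k ℕ (Coh k I') n ∘ₗ cohMap hφ n)
    rfl
    (fun {n m} a b => by
      obtain ⟨f, rfl⟩ := Submodule.Quotient.mk_surjective _ a
      obtain ⟨g, rfl⟩ := Submodule.Quotient.mk_surjective _ b
      simp only [LinearMap.comp_apply, DirectSum.lof_eq_of, DirectSum.of_mul_of]
      rfl)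

theorem cohRingMap_apply (x : CohRing k I) (n : ℕ) : cohRingMap hφ x n = cohMap hφ n (x n) := by
  have : (cohRingMap hφ).toLinearMap = DirectSum.lmap (cohMap hφ) := by
    refine DirectSum.linearMap_ext k fun n => LinearMap.ext fun a => ?_
    simp only [LinearMap.comp_apply, DirectSum.lmap_lof]
    exact DirectSum.toModule_lof k n a
  rw [← AlgHom.toLinearMap_apply, this, DirectSum.lmap_apply]

theorem cohRingMap_of {n : ℕ} (a : Coh k I n) :
    cohRingMap hφ (DirectSum.of (Coh k I) n a) = DirectSum.of (Coh k I') n (cohMap hφ n a) :=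
  DirectSum.toModule_lof k n a

theorem mem_piece_iff {n : ℕ} {x : CohRing k I} :
    x ∈ CohRing.piece k I n ↔ ∀ m, m ≠ n → x m = 0 := by
  classical
  refine ⟨?_, fun h => ⟨x n, DFinsupp.ext fun m => ?_⟩⟩
  · rintro ⟨a, rfl⟩ m hm
    exact DirectSum.of_eq_of_ne _ _ _ hm
  · by_cases hm : m = n
    · subst hm
      exact DirectSum.of_eq_same _ _
    · exact (DirectSum.of_eq_of_ne _ _ _ hm).trans (h m hm).symm

theorem cohRingMap_injective (hinj : ∀ n, Function.Injective (cohMap hφ n)) :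
    Function.Injective (cohRingMap hφ) := fun x y hxy => DFinsupp.ext fun n => hinj n (by
  have := congrArg (fun z : CohRing k I' => z n) hxy
  simpa only [cohRingMap_apply] using this)

theorem mem_range_cohRingMap_iff {x : CohRing k I'} :
    x ∈ (cohRingMap hφ).range ↔ ∀ n, x n ∈ LinearMap.range (cohMap hφ n) := by
  classical
  refine ⟨?_, fun h => ?_⟩
  · rintro ⟨y, rfl⟩ n
    exact ⟨y n, (cohRingMap_apply hφ y n).symm⟩
  · rw [← DirectSum.sum_support_of x]
    refine Subalgebra.sum_mem _ fun n _ => ?_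
    obtain ⟨a, ha⟩ := h n
    exact ⟨DirectSum.of _ n a, by rw [← ha]; exact cohRingMap_of hφ a⟩

theorem cohRingMap_mem_piece_iff (hinj : ∀ n, Function.Injective (cohMap hφ n)) {n : ℕ}
    {x : CohRing k I} : cohRingMap hφ x ∈ CohRing.piece k I' n ↔ x ∈ CohRing.piece k I n := by
  simp only [mem_piece_iff, cohRingMap_apply, map_eq_zero_iff _ (hinj _)]

end CohMap

/-! ### Restriction as an isomorphism onto the invariants. -/

section Main

open Coalgebra HopfAlgebra

variable {k : Type*} [Field k] {Λ : Type*} [Ring Λ] [Algebra k Λ] {H : Type*} [Ring H]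
  [HopfAlgebra k H] [Module H Λ] [IsScalarTower k H Λ] [IsModuleAlgebra k H Λ]
  (ε : Λ →ₐ[k] k) (hε : ∀ (h : H) (x : Λ), ε (h • x) = counit h * ε x) {t : H}

/-- The map `h ↦ 1 # h(1 - t)` to the augmentation ideal of `Λ # H`. -/
def augInrOf (t : H) : H →ₗ[k] augIdeal (smashAug ε hε) :=
  augInr ε hε ∘ₗ (LinearMap.id - (counit (R := k)).smulRight t)

theorem augInrOf_apply (t h : H) :
    augInrOf ε hε t h = augInr ε hε (h - counit (R := k) h • t) := rfl

theorem augInr_mul_augInr (h g : H) : augInr ε hε h * augInr ε hε g =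
    augInr ε hε (h * g - counit (R := k) g • h - counit (R := k) h • g) := by
  rw [augInr_mul, augLeft_augInr, map_sub _ (_ - _), map_smul]

theorem IsNormalizedIntegral.augInr_mul_augInrOf (ht : IsNormalizedIntegral k t) {h : H}
    (hh : counit (R := k) h = 0) (g : H) :
    augInr ε hε h * augInrOf ε hε t g = augInrOf ε hε t (h * g) := by
  rw [augInrOf_apply, augInrOf_apply, augInr_mul_augInr]
  congr 1
  simp [hh, mul_sub, ht.mul_left, ht.counit_eq]

theorem IsNormalizedIntegral.augInrOf_mul_augInr (ht : IsNormalizedIntegral k t) {h : H}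
    (hh : counit (R := k) h = 0) (g : H) :
    augInrOf ε hε t g * augInr ε hε h = augInrOf ε hε t (g * h) := by
  rw [augInrOf_apply, augInrOf_apply, augInr_mul_augInr]
  congr 1
  simp [hh, sub_mul, ht.mul_right, ht.counit_eq]

/-- This holds because `1 - t` is a central idempotent: `h ↦ h(1 - t)` is multiplicative, and its
image `H₊` has unit `1 - t`. -/
theorem IsNormalizedIntegral.augInrOf_mul_augInrOf (ht : IsNormalizedIntegral k t) (g h : H) :
    augInrOf ε hε t g * augInrOf ε hε t h = augInrOf ε hε t (g * h) := by
  rw [augInrOf_apply ε hε t h, ht.augInrOf_mul_augInr ε hε (by simp [ht.counit_eq]), mul_sub,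
    map_sub, mul_smul_comm, ht.mul_left, map_smul, map_smul, augInrOf_apply ε hε t t,
    ht.counit_eq, one_smul, sub_self, map_zero, smul_zero, smul_zero, sub_zero]

theorem exists_counit_eq_zero {x : augIdeal (smashAug ε hε)}
    (hx : x ∈ Set.range (augInr ε hε)) : ∃ h : H, counit (R := k) h = 0 ∧ augInr ε hε h = x := by
  obtain ⟨h, rfl⟩ := hx
  refine ⟨h - counit (R := k) h • 1, by simp, ?_⟩
  rw [map_sub, map_smul, augInr_one, smul_zero, sub_zero]

/-- Both legs of `S(t₍₁₎) ⊗ t₍₂₎` are projected to `H₊` by `1 - t`, which preserves the Casimir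
identity. The unit is the projection of `S(t₍₁₎)t₍₂₎ = ε(t)1 = 1`. -/
theorem IsNormalizedIntegral.isCasimir (ht : IsNormalizedIntegral k t) {ι : Type*}
    (s : Repr k t ι) : IsCasimir k (Set.range (augInr ε hε)) s.index
      (fun i => augInrOf ε hε t (antipode k (s.left i))) (fun i => augInrOf ε hε t (s.right i)) := by
  have hunit : ∑ i ∈ s.index, augInrOf ε hε t (antipode k (s.left i)) *
      augInrOf ε hε t (s.right i) = augInrOf ε hε t 1 := by
    simp only [ht.augInrOf_mul_augInrOf, ← map_sum]
    rw [sum_antipode_mul_eq_smul, ht.counit_eq, one_smul]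
  have hof : ∀ h : H, counit (R := k) h = 0 → augInrOf ε hε t h = augInr ε hε h := fun h hh => by
    rw [augInrOf_apply, hh, zero_smul, sub_zero]
  refine ⟨fun x hx => ?_, ?_, fun x hx => ?_, fun x hx => ?_⟩
  · obtain ⟨h, hh, rfl⟩ := exists_counit_eq_zero ε hε hx
    simp only [ht.augInr_mul_augInrOf ε hε hh, ht.augInrOf_mul_augInr ε hε hh]
    have := congrArg (TensorProduct.map (augInrOf ε hε t) (augInrOf ε hε t)) (ht.casimir s h)
    simpa only [map_sum, TensorProduct.map_tmul] using this
  · rw [hunit]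
    exact ⟨_, rfl⟩
  · obtain ⟨h, hh, rfl⟩ := exists_counit_eq_zero ε hε hx
    rw [hunit, ht.augInr_mul_augInrOf ε hε hh, mul_one, hof h hh]
  · obtain ⟨h, hh, rfl⟩ := exists_counit_eq_zero ε hε hx
    rw [hunit, ht.augInrOf_mul_augInr ε hε hh, one_mul, hof h hh]

theorem IsNormalizedIntegral.exists_vanishesOn (ht : IsNormalizedIntegral k t) {n : ℕ}
    (f : Cocycle k (augIdeal (smashAug ε hε)) n) :
    ∃ g : Cocycle k (augIdeal (smashAug ε hε)) n, VanishesOn (Set.range (augInr ε hε)) g.1 ∧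
      f.1 - g.1 ∈ coboundaries k (augIdeal (smashAug ε hε)) n := by
  cases n with
  | zero => exact ⟨f, fun _ i => i.elim0, by rw [sub_self]; exact zero_mem _⟩
  | succ n =>
    obtain ⟨g, hg⟩ := (ht.isCasimir ε hε (ℛ k t)).exists_vanishesOn_cochain f.1 f.2
    refine ⟨⟨f.1 - d k n g, ?_⟩, hg, ⟨g, by rw [sub_sub_cancel]⟩⟩
    have hf : d k (n + 1) f.1 = 0 := f.2
    change d k (n + 1) (f.1 - d k n g) = 0
    rw [map_sub, hf, d_d, sub_zero]

/-- Averaging by `t` produces invariants. As pullback is a right action, the relation needed is `th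
= ε(h)t`. -/
theorem IsNormalizedIntegral.pullback_pullback (ht : IsNormalizedIntegral k t) {n : ℕ}
    (f : Cochain k (augIdeal ε) n) (h : H) :
    pullback (augAct ε hε) n h (pullback (augAct ε hε) n t f) =
      counit (R := k) h • pullback (augAct ε hε) n t f := by
  rw [← pullback_mul_apply (augAct_mul ε hε), ht.mul_right, map_smul, LinearMap.smul_apply]

/-- Choose a representative vanishing on `H₊`, so that it is the inflation of its restriction. A
primitive of the restriction can be averaged to an invariant one, and its inflation is then a
primitive upstairs. -/
theorem IsNormalizedIntegral.cohMap_injective (ht : IsNormalizedIntegral k t) (n : ℕ) :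
    Function.Injective (cohMap (augInl_mul (H := H) ε hε) n) := by
  rw [injective_iff_map_eq_zero]
  intro x hx
  obtain ⟨f, rfl⟩ := Submodule.Quotient.mk_surjective _ x
  obtain ⟨g, hg, hfg⟩ := ht.exists_vanishesOn ε hε f
  rw [coh_mk_eq_mk.2 hfg] at hx ⊢
  rw [cohMap_mk, coh_mk_eq_zero, cocycleMap_val] at hx
  rw [coh_mk_eq_zero, ← inflate_cochainMap_of_vanishesOn hg g.2]
  have hinv := pullback_cochainMap_of_vanishesOn hg g.2
  generalize cochainMap (augInl ε hε) n g.1 = F at hx hinv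
  match n, F, hx with
  | 0, F, hx =>
    have : F = 0 := hx
    rw [this, map_zero]
    exact zero_mem _
  | n + 1, _, ⟨F, rfl⟩ =>
    -- Averaging `F` leaves `d F` unchanged, because `d F` is already invariant and `ε(t) = 1`.
    refine ⟨inflate ε hε n (pullback (augAct ε hε) n t F), ?_⟩
    rw [d_inflate (ht.pullback_pullback ε hε F), d_pullback (augAct_actsOnMul ε hε), hinv,
      ht.counit_eq, one_smul]

/-- Restrictions are invariant already on cocycles, for representatives vanishing on `H₊`.
Conversely, the averaged representative of an invariant class is a strictly invariant cocycle, and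
its inflation is a cocycle restricting to it. -/
theorem IsNormalizedIntegral.mem_range_cohMap_iff (ht : IsNormalizedIntegral k t) {n : ℕ}
    (x : Coh k (augIdeal ε) n) : x ∈ LinearMap.range (cohMap (augInl_mul (H := H) ε hε) n) ↔
      ∀ h : H, cohPullback (augAct_actsOnMul ε hε) n h x = counit (R := k) h • x := by
  constructor
  · rintro ⟨y, rfl⟩ h
    obtain ⟨f, rfl⟩ := Submodule.Quotient.mk_surjective _ y
    obtain ⟨g, hg, hfg⟩ := ht.exists_vanishesOn ε hε f
    rw [coh_mk_eq_mk.2 hfg, cohMap_mk]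
    exact congrArg Submodule.Quotient.mk (Subtype.ext
      (pullback_cochainMap_of_vanishesOn hg g.2 h) : cocyclePullback (augAct_actsOnMul ε hε) n h
        (cocycleMap _ n g) = counit (R := k) h • cocycleMap _ n g)
  · intro hx
    obtain ⟨f, rfl⟩ := Submodule.Quotient.mk_surjective _ x
    have hf : d k n f.1 = 0 := f.2
    have hinv := ht.pullback_pullback ε hε f.1
    have hd : d k n (inflate ε hε n (pullback (augAct ε hε) n t f.1)) = 0 := by
      rw [d_inflate hinv, d_pullback (augAct_actsOnMul ε hε), hf, map_zero, map_zero]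
    let F : Cocycle k (augIdeal (smashAug ε hε)) n := ⟨_, hd⟩
    refine ⟨Submodule.Quotient.mk F, ?_⟩
    -- Invariance at `t` itself says that averaging does not change the class.
    have h1 := hx t
    rw [ht.counit_eq, one_smul] at h1
    refine Eq.trans ?_ h1
    exact congrArg Submodule.Quotient.mk (Subtype.ext (cochainMap_inflate ε hε _) :
      cocycleMap (augInl_mul ε hε) n F = cocyclePullback (augAct_actsOnMul ε hε) n t f)

theorem yonedaAct_apply (h : H) (ω : YonedaRing ε) (n : ℕ) : yonedaAct ε hε h ω n =
    cohPullback (augAct_actsOnMul ε hε) n (antipodeInv k H h) (ω n) :=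
  DirectSum.lmap_apply _ _ _

/-- Restriction to `Λ` identifies the Yoneda ring of `Λ # H` with the invariants of the Yoneda ring
of `Λ`. -/
theorem IsNormalizedIntegral.exists_algEquiv (ht : IsNormalizedIntegral k t) :
    ∃ I : Subalgebra k (YonedaRing ε),
      (∀ ω, ω ∈ I ↔ ∀ h : H, yonedaAct ε hε h ω = counit (R := k) h • ω) ∧
      ∃ φ : YonedaRing (smashAug (H := H) ε hε) ≃ₐ[k] I,
        ∀ (n : ℕ) x, x ∈ YonedaRing.piece _ n ↔ (φ x : YonedaRing ε) ∈ YonedaRing.piece _ n := by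
  have hinj := ht.cohMap_injective ε hε
  have hS := ht.antipode_bijective
  refine ⟨(cohRingMap (augInl_mul (H := H) ε hε)).range, fun ω => ?_,
    AlgEquiv.ofInjective _ (cohRingMap_injective _ hinj),
    fun n x => (cohRingMap_mem_piece_iff _ hinj).symm⟩
  -- As `h` runs over `H`, so does `S⁻¹(h)`, with the same counit; both notions of invariance
  -- therefore coincide.
  rw [mem_range_cohRingMap_iff, forall_congr' fun n => ht.mem_range_cohMap_iff ε hε (ω n),
    forall_comm, (antipodeInv_surjective hS).forall]
  refine forall_congr' fun h => ?_
  simp only [counit_antipodeInv hS, ← yonedaAct_apply]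
  exact ⟨fun e => DFinsupp.ext e, fun e n => congrArg (fun z : YonedaRing ε => z n) e⟩

end Main

end BarCohomology

end

/-! ### The theorem, for module algebras and for Yetter–Drinfeld algebras. -/

theorem mainTheorem6 {k : Type*} [Field k] {H : Type*} [Ring H] [HopfAlgebra k H]
    [IsSemisimpleRing H] :
    FiniteDimensional k H ∧ Function.Bijective (HopfAlgebra.antipode k : H →ₗ[k] H) ∧
    (∀ (Λ : Type*) [Ring Λ] [Algebra k Λ] [FiniteDimensional k Λ] [Module H Λ]
      [IsScalarTower k H Λ] [IsModuleAlgebra k H Λ] (𝒜 : ℕ → Submodule k Λ) [GradedAlgebra 𝒜]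
      (hconn : IsConnectedGrading 𝒜) (hst : ∀ (n : ℕ) (h : H), ∀ x ∈ 𝒜 n, h • x ∈ 𝒜 n),
      ∃ I : Subalgebra k (YonedaRing (connectedAug 𝒜 hconn)),
        (∀ ω, ω ∈ I ↔ ∀ h : H,
          yonedaAct (connectedAug 𝒜 hconn) (connectedAug_smul 𝒜 hconn hst) h ω =
            Coalgebra.counit (R := k) h • ω) ∧
        ∃ φ : YonedaRing (smashAug (connectedAug 𝒜 hconn)
            (connectedAug_smul (H := H) 𝒜 hconn hst)) ≃ₐ[k] I,
          ∀ (n : ℕ) x, x ∈ YonedaRing.piece _ n ↔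
            (φ x : YonedaRing (connectedAug 𝒜 hconn)) ∈ YonedaRing.piece _ n) ∧
    (∀ (Λ : Type*) [Ring Λ] [Algebra k Λ] [FiniteDimensional k Λ] [Module H Λ]
      [IsScalarTower k H Λ] (ρ : Λ →ₗ[k] TensorProduct k H Λ) (_ : IsYetterDrinfeldAlgebra ρ)
      (𝒜 : ℕ → Submodule k Λ) [GradedAlgebra 𝒜] (hconn : IsConnectedGrading 𝒜)
      (hst : ∀ (n : ℕ) (h : H), ∀ x ∈ 𝒜 n, h • x ∈ 𝒜 n)
      (_ : ∀ (n : ℕ), ∀ x ∈ 𝒜 n, ρ x ∈ LinearMap.range ((𝒜 n).subtype.lTensor H)),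
      ∃ _ : IsModuleAlgebra k H Λ, ∃ I : Subalgebra k (YonedaRing (connectedAug 𝒜 hconn)),
        (∀ ω, ω ∈ I ↔ ∀ h : H,
          yonedaAct (connectedAug 𝒜 hconn) (connectedAug_smul 𝒜 hconn hst) h ω =
            Coalgebra.counit (R := k) h • ω) ∧
        ∃ φ : YonedaRing (smashAug (connectedAug 𝒜 hconn)
            (connectedAug_smul (H := H) 𝒜 hconn hst)) ≃ₐ[k] I,
          ∀ (n : ℕ) x, x ∈ YonedaRing.piece _ n ↔
            (φ x : YonedaRing (connectedAug 𝒜 hconn)) ∈ YonedaRing.piece _ n) := by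
  obtain ⟨t, ht⟩ := exists_isNormalizedIntegral k (H := H)
  refine ⟨ht.finiteDimensional, ht.antipode_bijective, ?_, ?_⟩
  · intro Λ _ _ _ _ _ _ 𝒜 _ hconn hst
    exact ht.exists_algEquiv _ (connectedAug_smul 𝒜 hconn hst)
  · intro Λ _ _ _ _ _ ρ hρ 𝒜 _ hconn hst _
    have : IsModuleAlgebra k H Λ := hρ.toIsModuleAlgebra
    exact ⟨this, ht.exists_algEquiv _ (connectedAug_smul 𝒜 hconn hst)⟩
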